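/- Consider a $1{+}1$-dimensional theory of finitely many massive scalar fields $\phi_1,\dots,\phi_r$ with a real Lagrangian $$\mathcal L=\sum_{a=1}^r\Bigl(\tfrac12\partial_\mu\phi_a\partial^\mu\phi_{\bar a}-\tfrac12 m_a^2\,\phi_a\phi_{\bar a}\Bigr)-\sum_{n\ge 3}\frac1{n!}\sum_{a_1,\dots,a_n=1}^r C^{(n)}_{a_1\dots a_n}\,\phi_{a_1}\cdots\phi_{a_n},$$ where $m_a=m_{\bar a}>0$, $\phi_{\bar a}=\phi_a^*$, and $a\mapsto\bar a$ is an involution of $\{1,\dots,r\}$ (a field is real if $\bar a=a$). Assume that the theory does not split into two mutually non-interacting theories: the fields cannot be divided into two nonempty classes, each closed under conjugation, such that every interaction term with nonzero coupling only contains fields of one class. Tree-level amplitudes are the sums of all connected tree Feynman diagrams, with vertices $-iC^{(n)}_{a_1\dots a_n}$ and propagators $i/(P^2-m_e^2)$. Suppose that the theory is purely elastic at tree level: for real rapidities and conserved energy and momentum, every tree-level amplitude in which the outgoing particles are not the incoming ones, with the same types and the same momenta, vanishes (wherever no propagator is singular). Let $M^{(0)}_{ij}(\theta)$ be the tree-level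 amplitude of the elastic process $i+j\to i+j$, in which both particles keep their momenta and $\theta$ is the difference of their rapidities. Then there is a constant $a_\infty\in\mathbb C$, independent of the particle types, such that for all $i,j\in\{1,\dots,r\}$ the limit $M^{(0)}_{ij}(\infty)=\lim_{\theta\to+\infty}M^{(0)}_{ij}(\theta)$ exists and $$\frac{M^{(0)}_{ij}(\infty)}{m_i^2\,m_j^2}=a_\infty .$$ -/

import Mathlib

open Filter Topology

/-- The data of a real Lagrangian for finitely many massive scalar fields `φ_1, …, φ_r` in `1+1`
dimensions,
`∑ a, (∂φ_a ∂φ_{bar a} / 2 - m_a ^ 2 φ_a φ_{bar a} / 2)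
  - ∑ n ≥ 3, (1 / n!) ∑ a_1 … a_n, C_{a_1 … a_n} φ_{a_1} ⋯ φ_{a_n}`,
where `φ_{bar a}` is the complex conjugate of `φ_a`. The couplings are symmetric in their indices
because the fields commute, so they are indexed by multisets; only multisets with at least three
elements occur in the Lagrangian. -/
structure ScalarTheory (r : ℕ) where
  /-- charge conjugation `a ↦ bar a`; a field is real iff it is fixed by it -/
  bar : Fin r → Fin r
  bar_bar : ∀ a, bar (bar a) = a
  /-- the masses -/
  mass : Fin r → ℝ
  mass_pos : ∀ a, 0 < mass a
  mass_bar : ∀ a, mass (bar a) = mass a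
  /-- the couplings `C_{a_1 … a_n}` -/
  coupling : Multiset (Fin r) → ℂ
  /-- the potential is real -/
  coupling_bar : ∀ s : Multiset (Fin r), 3 ≤ s.card →
    coupling (s.map bar) = (starRingEnd ℂ) (coupling s)

namespace ScalarTheory

/-- Two-momenta are pairs of light-cone components `(p_0 + p_1, p_0 - p_1)`; this is the Minkowski
square. -/
def msq (P : ℝ × ℝ) : ℝ := P.1 * P.2

/-- The on-shell momentum of a particle of mass `m` and rapidity `θ`. -/
noncomputable def onShell (m θ : ℝ) : ℝ × ℝ := (m * Real.exp θ, m * Real.exp (-θ))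

section Diagrams

variable {L : Type} [Fintype L] [DecidableEq L]

/-- A tree diagram with external legs labelled by `L` and all vertices of valence at least three,
given by the set `F` of its internal lines. Cutting an internal line splits the legs into two parts
with at least two legs each; the line is named by the part that does not contain the reference leg
`o`. A set of such parts comes from a (unique) tree iff any two of them are nested or disjoint. -/
def IsTreeDiagram (o : L) (F : Finset (Finset L)) : Prop :=
  (∀ S ∈ F, o ∉ S ∧ 2 ≤ S.card ∧ S.card + 2 ≤ Fintype.card L) ∧
    ∀ S ∈ F, ∀ T ∈ F, S ⊆ T ∨ T ⊆ S ∨ Disjoint S T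

instance (o : L) : DecidablePred (IsTreeDiagram o) := fun F => by
  unfold IsTreeDiagram; infer_instance

/-- The vertices of the diagram `F` correspond to the sets `S` in `F` (the endpoint, far from the
reference leg, of the line `S`) and to the set of all legs except the reference leg (the vertex at
the reference leg). This is the finset of external legs in `S` attached to the vertex `S`. -/
def legsAt (F : Finset (Finset L)) (S : Finset L) : Finset L :=
  S.filter fun i => ∀ U ∈ F, U ⊂ S → i ∉ U

/-- The internal lines that leave the vertex `S` away from the reference leg: the maximal elements
of `F` strictly below `S`. -/
def linesAt (F : Finset (Finset L)) (S : Finset L) : Finset F :=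
  Finset.univ.filter fun T => T.1 ⊂ S ∧ ∀ U ∈ F, T.1 ⊂ U → ¬ U ⊂ S

/-- The field indices at the vertex `S`, apart from the one on the side of the reference leg, for
external legs of types `a` and internal lines of types `τ`. -/
def fieldsAt {r : ℕ} (a : L → Fin r) (F : Finset (Finset L)) (τ : F → Fin r) (S : Finset L) :
    Multiset (Fin r) :=
  (legsAt F S).val.map a + (linesAt F S).val.map τ

variable {r : ℕ} (T : ScalarTheory r)

/-- The value of the diagram `F` by the Feynman rules, for incoming legs of types `a` and momenta
`p`: a factor `-i C` for each vertex, a factor `i / (P ^ 2 - m_e ^ 2)` for each internal line of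
type `e` and momentum `P` (it joins a field `φ_e` to a field `φ_{bar e}`), and a sum over the types
of all internal lines. -/
noncomputable def diagramValue (o : L) (a : L → Fin r) (p : L → ℝ × ℝ) (F : Finset (Finset L)) :
    ℂ :=
  ∑ τ : F → Fin r,
    (-Complex.I * T.coupling (a o ::ₘ fieldsAt a F τ (Finset.univ.erase o))) *
      ∏ S : F, (Complex.I / ((msq (∑ i ∈ S.1, p i) - T.mass (τ S) ^ 2 : ℝ) : ℂ)) *
        (-Complex.I * T.coupling (T.bar (τ S) ::ₘ fieldsAt a F τ S.1))

/-- The sum of all tree diagrams with incoming legs of types `a` and momenta `p`. It does not depend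
on the reference leg `o` when momentum is conserved. -/
noncomputable def treeSum (o : L) (a : L → Fin r) (p : L → ℝ × ℝ) : ℂ :=
  ∑ F ∈ Finset.univ.filter (IsTreeDiagram o), T.diagramValue o a p F

/-- No propagator can be singular: no proper subset of the legs that may be separated by an internal
line has a total momentum on one of the mass shells. -/
def Nonsingular (p : L → ℝ × ℝ) : Prop :=
  ∀ S : Finset L, 2 ≤ S.card → S.card + 2 ≤ Fintype.card L → ∀ e : Fin r,
    msq (∑ i ∈ S, p i) ≠ T.mass e ^ 2

end Diagrams

variable {r : ℕ} (T : ScalarTheory r)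

/-- Types of the legs, all taken as incoming, of a process with incoming particles of types `a` and
outgoing particles of types `b`: an outgoing particle counts as an incoming antiparticle. -/
def legType {m n : ℕ} (a : Fin m → Fin r) (b : Fin n → Fin r) : Fin m ⊕ Fin n → Fin r :=
  Sum.elim a fun j => T.bar (b j)

/-- Momenta of the legs, all taken as incoming, for incoming rapidities `α` and outgoing rapidities
`β`. -/
noncomputable def legMomentum {m n : ℕ} (a : Fin m → Fin r) (α : Fin m → ℝ) (b : Fin n → Fin r)
    (β : Fin n → ℝ) : Fin m ⊕ Fin n → ℝ × ℝ :=
  Sum.elim (fun i => onShell (T.mass (a i)) (α i)) fun j => -onShell (T.mass (b j)) (β j)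

/-- The tree-level amplitude `M^(0)` for incoming particles of types `a` and rapidities `α` and
outgoing particles of types `b` and rapidities `β`. -/
noncomputable def treeAmplitude {m n : ℕ} (a : Fin (m + 1) → Fin r) (α : Fin (m + 1) → ℝ)
    (b : Fin n → Fin r) (β : Fin n → ℝ) : ℂ :=
  T.treeSum (Sum.inl 0) (T.legType a b) (T.legMomentum a α b β)

/-- The theory is purely elastic at tree level: every process that conserves energy and momentum,
with physical (real) rapidities, whose outgoing particles are not the incoming particles with the
same types and momenta, has vanishing tree-level amplitude. The amplitude is evaluated where its
propagators are finite, so that the `iε` prescription plays no role. (There is at least one incoming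
particle, as otherwise energy is not conserved, and at least three particles in total.) -/
def PurelyElastic : Prop :=
  ∀ (m n : ℕ) (a : Fin (m + 1) → Fin r) (α : Fin (m + 1) → ℝ) (b : Fin n → Fin r) (β : Fin n → ℝ),
    3 ≤ (m + 1) + n →
    ∑ i, onShell (T.mass (a i)) (α i) = ∑ j, onShell (T.mass (b j)) (β j) →
    (Finset.univ.val.map fun i => (a i, α i)) ≠ (Finset.univ.val.map fun j => (b j, β j)) →
    T.Nonsingular (T.legMomentum a α b β) →
    T.treeAmplitude a α b β = 0

/-- The theory does not split into two theories without mutual interaction: the fields cannot be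
divided into two nonempty classes, each closed under conjugation, such that no interaction term
contains fields of both classes. -/
def Indecomposable : Prop :=
  ∀ A : Finset (Fin r), A.Nonempty → A ≠ Finset.univ → (∀ a ∈ A, T.bar a ∈ A) →
    ∃ s : Multiset (Fin r), 3 ≤ s.card ∧ T.coupling s ≠ 0 ∧ (∃ a ∈ s, a ∈ A) ∧ ∃ b ∈ s, b ∉ A

/-- The tree-level amplitude `M^(0)_{ij}(θ)` of the elastic process in which particles of types `i`
and `j` with rapidity difference `θ` keep their momenta. By relativistic invariance it is enough to
take the rapidities `θ` and `0`. -/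
noncomputable def elasticAmplitude (i j : Fin r) (θ : ℝ) : ℂ :=
  T.treeAmplitude ![i, j] ![θ, 0] ![i, j] ![θ, 0]

end ScalarTheory

/-! Let a particle of type `i` become infinitely fast and pass forward, while slow particles keep
finite momenta. In light-cone components the total slow momentum tends to `(D, 0)`. A line
separating the two fast legs has a squared momentum tending to infinity, so it drops out. The
surviving diagrams have both fast legs at one vertex; they come in pairs, with or without the line
that carries the whole slow momentum. That line has squared momentum `0` in the limit, so each pair
merges into one diagram whose root is the effective vertex `forwardVertex i`, written `W(s)` below.
With two slow legs only `W` remains. Elasticity therefore gives `W {c, e} = 0` unless `e = bar c`,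
and the elastic amplitude tends to `-i W {j, bar j}`, which is symmetric in `i` and `j`. Put `g a =
W {a, bar a} / m_a ^ 2` (`forwardRatio`). It remains to show that `g` does not depend on `a`: the
symmetry then makes the quotient by both squared masses universal. By indecomposability it suffices
that `g` is constant on the fields of every nonzero coupling (`PurelyElastic.uniform`). This goes by
strong induction on the size of the multiset `s`. If `g` is not constant on `s`, then diagrams built
from smaller vertices vanish, since uniform vertices propagate one value of `g` through the tree.
What is left is `W(s)` itself and the diagrams in which one slow leg `x` first meets the root `W {a
x, bar (a x)}` and the full coupling `C_s` follows. The propagator of the latter is `-i / (D *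
p_x.2)`, and `m ^ 2 = p_x.1 * p_x.2`, so the vanishing amplitude reads `∑ x, (W(s) - C_s * g (a x))
* p_x.1 = 0` (`forwardVertex_relation`). Widely separated slow momenta isolate any chosen field `d`,
whence `W(s) = C_s * g d` for all `d` in `s`, and so `C_s = W(s) = 0`. -/

namespace ScalarTheory

/-! ### Limits of tree sums at infinite momentum -/

section Limit

variable {L : Type} [Fintype L] [DecidableEq L] {r : ℕ} (T : ScalarTheory r)

/-- The value of a diagram as a function of the squared momenta `σ S` of its internal lines. -/
noncomputable def diagramValueOfSq (o : L) (a : L → Fin r) (σ : Finset L → ℝ)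
    (F : Finset (Finset L)) : ℂ :=
  ∑ τ : F → Fin r,
    (-Complex.I * T.coupling (a o ::ₘ fieldsAt a F τ (Finset.univ.erase o))) *
      ∏ S : F, (Complex.I / ((σ S.1 - T.mass (τ S) ^ 2 : ℝ) : ℂ)) *
        (-Complex.I * T.coupling (T.bar (τ S) ::ₘ fieldsAt a F τ S.1))

/-- A propagator vanishes as the square of its momentum goes to infinity. -/
theorem tendsto_propagator_zero {ι : Type*} {l : Filter ι} {f : ι → ℝ} (c : ℝ)
    (hf : Tendsto (fun n => |f n|) l atTop) :
    Tendsto (fun n => Complex.I / ((f n - c : ℝ) : ℂ)) l (𝓝 0) := by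
  rw [tendsto_zero_iff_norm_tendsto_zero]
  have h : Tendsto (fun n => |f n - c|) l atTop := by
    refine tendsto_atTop_mono (fun n => ?_) (tendsto_atTop_add_const_right l (-|c|) hf)
    have := abs_sub_abs_le_abs_sub (f n) c
    linarith
  have h2 := h.inv_tendsto_atTop
  refine h2.congr fun n => ?_
  simp [Complex.norm_real, -Complex.ofReal_sub]

/-- If the momenta of all lines separating the legs `o` and `o'` become infinite, only the diagrams
without such lines survive. -/
theorem tendsto_treeSum {ι : Type*} {l : Filter ι} (o o' : L) (a : L → Fin r)
    (p : ι → L → ℝ × ℝ) (σ : Finset L → ℝ)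
    (h₁ : ∀ S, o ∉ S → o' ∈ S → 2 ≤ S.card → S.card + 2 ≤ Fintype.card L →
      Tendsto (fun n => |msq (∑ i ∈ S, p n i)|) l atTop)
    (h₂ : ∀ S, o ∉ S → o' ∉ S → Tendsto (fun n => msq (∑ i ∈ S, p n i)) l (𝓝 (σ S)))
    (h₃ : ∀ S, o ∉ S → o' ∉ S → 2 ≤ S.card → S.card + 2 ≤ Fintype.card L →
      ∀ e, σ S ≠ T.mass e ^ 2) :
    Tendsto (fun n => T.treeSum o a (p n)) l
      (𝓝 (∑ F : Finset (Finset L) with IsTreeDiagram o F ∧ ∀ S ∈ F, o' ∉ S,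
        T.diagramValueOfSq o a σ F)) := by
  unfold treeSum
  rw [← Finset.filter_filter, Finset.sum_filter]
  refine tendsto_finsetSum _ fun F hF => ?_
  have hF := (Finset.mem_filter.1 hF).2
  -- Factor by factor, each propagator has its own limit: zero if the line separates `o` from `o'`,
  -- the finite value otherwise.
  have key : Tendsto (fun n => T.diagramValue o a (p n) F) l
      (𝓝 (∑ τ : F → Fin r,
        (-Complex.I * T.coupling (a o ::ₘ fieldsAt a F τ (Finset.univ.erase o))) *
        ∏ S : F, (if o' ∈ S.1 then 0 else (Complex.I / ((σ S.1 - T.mass (τ S) ^ 2 : ℝ) : ℂ))) *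
          (-Complex.I * T.coupling (T.bar (τ S) ::ₘ fieldsAt a F τ S.1)))) := by
    unfold diagramValue
    refine tendsto_finsetSum _ fun τ _ => Tendsto.const_mul _ ?_
    refine tendsto_finsetProd _ fun S _ => Tendsto.mul_const _ ?_
    obtain ⟨ho, hc, hc'⟩ := hF.1 S.1 S.2
    split_ifs with h
    · exact tendsto_propagator_zero _ (h₁ S.1 ho h hc hc')
    · refine Tendsto.div tendsto_const_nhds ?_ ?_
      · exact (Complex.continuous_ofReal.tendsto _).comp ((h₂ S.1 ho h).sub_const _)
      · exact_mod_cast sub_ne_zero.2 (h₃ S.1 ho h hc hc' _)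
  convert key using 2
  split_ifs with h
  · unfold diagramValueOfSq
    refine Finset.sum_congr rfl fun τ _ => ?_
    congr 1
    refine Finset.prod_congr rfl fun S _ => ?_
    rw [if_neg (h S.1 S.2)]
  · push Not at h
    obtain ⟨S, hS, hS'⟩ := h
    refine (Finset.sum_eq_zero fun τ _ => ?_).symm
    rw [Finset.prod_eq_zero (Finset.mem_univ (⟨S, hS⟩ : F)), mul_zero]
    simp [hS']

end Limit
-- Merging diagrams into effective forward vertices
section Pairing

variable {L : Type} [Fintype L] [DecidableEq L] {r : ℕ} (T : ScalarTheory r)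

/-- The effective vertex, at zero momentum transfer, at which a particle of type `i` scatters
forward while emitting the fields `s`. -/
noncomputable def forwardVertex (i : Fin r) (s : Multiset (Fin r)) : ℂ :=
  T.coupling (i ::ₘ T.bar i ::ₘ s) -
    ∑ e, T.coupling (i ::ₘ T.bar i ::ₘ {e}) * T.coupling (T.bar e ::ₘ s) /
      ((T.mass e ^ 2 : ℝ) : ℂ)

/-- The legs other than `o` and `o'`. -/
def restLegs (o o' : L) : Finset L := (Finset.univ.erase o).erase o'

theorem mem_restLegs {o o' x : L} : x ∈ restLegs o o' ↔ x ≠ o' ∧ x ≠ o := by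
  simp [restLegs]

theorem card_restLegs {o o' : L} (h : o ≠ o') :
    (restLegs o o').card + 2 = Fintype.card L := by
  have h1 : o' ∈ Finset.univ.erase o := by simp [h.symm]
  have h2 := Finset.card_erase_add_one h1
  have h3 := Finset.card_erase_add_one (Finset.mem_univ o)
  rw [Finset.card_univ] at h3
  unfold restLegs
  omega

theorem restLegs_ssubset {o o' : L} (h : o ≠ o') : restLegs o o' ⊂ Finset.univ.erase o :=
  Finset.erase_ssubset (by simp [h.symm])

theorem insert_restLegs {o o' : L} (h : o ≠ o') :
    insert o' (restLegs o o') = Finset.univ.erase o :=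
  Finset.insert_erase (by simp [h.symm])

/-- The sum of the values of a diagram `G` with all lines below `restLegs o o'`, and of the same
diagram with the line `restLegs o o'` added. -/
noncomputable def reducedValue (o o' : L) (a : L → Fin r) (σ : Finset L → ℝ)
    (G : Finset (Finset L)) : ℂ :=
  ∑ τ : G → Fin r,
    (-Complex.I * T.forwardVertex (a o) (fieldsAt a G τ (restLegs o o'))) *
      ∏ S : G, (Complex.I / ((σ S.1 - T.mass (τ S) ^ 2 : ℝ) : ℂ)) *
        (-Complex.I * T.coupling (T.bar (τ S) ::ₘ fieldsAt a G τ S.1))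

theorem fieldsAt_insert (a : L → Fin r) {R : Finset L} {G : Finset (Finset L)}
    (τ : ↥(insert R G) → Fin r) {S : Finset L} (hS : ¬ R ⊂ S) :
    fieldsAt a (insert R G) τ S =
      fieldsAt a G (fun U => τ ⟨U.1, Finset.mem_insert_of_mem U.2⟩) S := by
  have h1 : legsAt (insert R G) S = legsAt G S := by
    unfold legsAt
    refine Finset.filter_congr fun x _ => ?_
    rw [Finset.forall_mem_insert]
    exact and_iff_right fun h => absurd h hS
  have h2 : linesAt (insert R G) S = (linesAt G S).map
      ⟨fun U => ⟨U.1, Finset.mem_insert_of_mem U.2⟩, fun U V h =>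
        Subtype.ext (Subtype.mk.inj h)⟩ := by
    ext ⟨U, hU⟩
    simp only [linesAt, Finset.mem_filter, Finset.mem_univ, true_and, Finset.mem_map,
      Finset.forall_mem_insert]
    constructor
    · rintro ⟨h3, -, h4⟩
      have hU' : U ∈ G := (Finset.mem_insert.1 hU).resolve_left fun h => hS (h ▸ h3)
      exact ⟨⟨U, hU'⟩, ⟨h3, h4⟩, rfl⟩
    · rintro ⟨V, ⟨h1, h2⟩, hV⟩
      obtain rfl : V.1 = U := congrArg Subtype.val hV
      exact ⟨h1, fun _ => hS, h2⟩
  unfold fieldsAt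
  rw [h1, h2, Finset.map_val, Multiset.map_map]
  rfl

theorem fieldsAt_erase (a : L → Fin r) {o o' : L} (h : o ≠ o') {G : Finset (Finset L)}
    (hG : ∀ S ∈ G, S ⊂ restLegs o o') (τ : G → Fin r) :
    fieldsAt a G τ (Finset.univ.erase o) = a o' ::ₘ fieldsAt a G τ (restLegs o o') := by
  have hG' : ∀ S ∈ G, S ⊂ Finset.univ.erase o := fun S hS =>
    (hG S hS).trans (restLegs_ssubset h)
  have h1 : legsAt G (Finset.univ.erase o) = insert o' (legsAt G (restLegs o o')) := by
    ext x
    simp only [legsAt, ← insert_restLegs h, Finset.mem_filter, Finset.mem_insert]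
    constructor
    · rintro ⟨rfl | hx, h2⟩
      · exact Or.inl rfl
      · exact Or.inr ⟨hx, fun U hU _ => h2 U hU (by rw [insert_restLegs h]; exact hG' U hU)⟩
    · rintro (rfl | ⟨hx, h2⟩)
      · refine ⟨Or.inl rfl, fun U hU _ hx => ?_⟩
        exact (mem_restLegs.1 ((hG U hU).subset hx)).1 rfl
      · exact ⟨Or.inr hx, fun U hU _ => h2 U hU (hG U hU)⟩
  have h2 : linesAt G (Finset.univ.erase o) = linesAt G (restLegs o o') := by
    ext ⟨U, hU⟩
    simp only [linesAt, Finset.mem_filter, Finset.mem_univ, true_and]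
    refine and_congr (by simp [hG U hU, hG' U hU]) (forall₂_congr fun V hV => ?_)
    simp [hG V hV, hG' V hV]
  have h3 : o' ∉ legsAt G (restLegs o o') := fun hx =>
    (mem_restLegs.1 (Finset.mem_filter.1 hx).1).1 rfl
  unfold fieldsAt
  rw [h1, h2, Finset.insert_val_of_notMem h3]
  simp

theorem fieldsAt_insert_erase (a : L → Fin r) {o o' : L} (h : o ≠ o') {G : Finset (Finset L)}
    (hG : ∀ S ∈ G, S ⊂ restLegs o o')
    (τ : ↥(insert (restLegs o o') G) → Fin r) :
    fieldsAt a (insert (restLegs o o') G) τ (Finset.univ.erase o) =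
      a o' ::ₘ {τ ⟨restLegs o o', Finset.mem_insert_self _ _⟩} := by
  have h1 : legsAt (insert (restLegs o o') G) (Finset.univ.erase o) = {o'} := by
    ext x
    simp only [legsAt, Finset.mem_filter, Finset.mem_singleton]
    constructor
    · rintro ⟨hx, h2⟩
      by_contra hne
      exact h2 _ (Finset.mem_insert_self _ _) (restLegs_ssubset h)
        (mem_restLegs.2 ⟨hne, by simpa using hx⟩)
    · rintro rfl
      refine ⟨by simp [h.symm], fun U hU _ hx => ?_⟩
      have : U ⊆ restLegs o x := by
        rcases Finset.mem_insert.1 hU with rfl | hU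
        · exact subset_rfl
        · exact (hG U hU).subset
      exact (mem_restLegs.1 (this hx)).1 rfl
  have h2 : linesAt (insert (restLegs o o') G) (Finset.univ.erase o) =
      {⟨restLegs o o', Finset.mem_insert_self _ _⟩} := by
    ext ⟨U, hU⟩
    simp only [linesAt, Finset.mem_filter, Finset.mem_univ, true_and, Finset.mem_singleton,
      Subtype.mk.injEq]
    constructor
    · rintro ⟨_, h2⟩
      rcases Finset.mem_insert.1 hU with rfl | hU
      · rfl
      · exact absurd (restLegs_ssubset h) (h2 _ (Finset.mem_insert_self _ _) (hG U hU))
    · rintro rfl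
      refine ⟨restLegs_ssubset h, fun V hV hV' => ?_⟩
      rcases Finset.mem_insert.1 hV with rfl | hV
      · exact absurd hV' (ssubset_irrefl _)
      · exact absurd (hV'.trans (hG V hV)) (ssubset_irrefl _)
  unfold fieldsAt
  rw [h1, h2]
  simp

theorem sum_insert_fun {α β M : Type*} [DecidableEq α] [Fintype β] [AddCommMonoid M]
    {R : α} {G : Finset α} (hR : R ∉ G) (f : (↥(insert R G) → β) → M) :
    ∑ τ, f τ = ∑ τ : G → β, ∑ e : β, f (fun U => ((Finset.subtypeInsertEquivOption hR) U).elim e τ) := by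
  rw [Finset.sum_comm, ← Fintype.sum_prod_type']
  symm
  refine Fintype.sum_equiv ((Equiv.piOptionEquivProd (β := fun _ => β)).symm.trans
    (Equiv.arrowCongr (Finset.subtypeInsertEquivOption hR).symm (Equiv.refl β))) _ _ ?_
  rintro ⟨e, τ⟩
  congr 1
  funext U
  simp only [Equiv.trans_apply, Equiv.arrowCongr_apply, Function.comp, Equiv.refl_apply,
    Equiv.symm_symm]
  cases (Finset.subtypeInsertEquivOption hR) U <;> rfl

theorem prod_insert_subtype {α M : Type*} [DecidableEq α] [CommMonoid M]
    {R : α} {G : Finset α} (hR : R ∉ G) (f : ↥(insert R G) → M) :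
    ∏ S, f S = f ⟨R, Finset.mem_insert_self _ _⟩ *
      ∏ S : G, f ⟨S.1, Finset.mem_insert_of_mem S.2⟩ := by
  rw [← Fintype.prod_equiv (Finset.subtypeInsertEquivOption hR).symm
    (fun S => f ((Finset.subtypeInsertEquivOption hR).symm S)) f (fun _ => rfl),
    Fintype.prod_option]
  rfl

theorem elim_insert_self {α β : Type*} [DecidableEq α] {R : α} {G : Finset α} (hR : R ∉ G)
    (e : β) (τ : G → β) :
    ((Finset.subtypeInsertEquivOption hR) ⟨R, Finset.mem_insert_self _ _⟩).elim e τ = e := by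
  simp [Finset.subtypeInsertEquivOption]

theorem elim_insert_of_mem {α β : Type*} [DecidableEq α] {R : α} {G : Finset α} (hR : R ∉ G)
    (e : β) (τ : G → β) (S : G) :
    ((Finset.subtypeInsertEquivOption hR) ⟨S.1, Finset.mem_insert_of_mem S.2⟩).elim e τ = τ S := by
  have : S.1 ≠ R := fun h => hR (h ▸ S.2)
  simp [Finset.subtypeInsertEquivOption, this]

/-- The extra line carries zero squared momentum, so its propagator is `-i / m_e ^ 2`; summing over
its type `e` produces exactly the subtraction in `forwardVertex`, and all factors below are shared
by the two diagrams. -/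
theorem diagramValueOfSq_add_insert (a : L → Fin r) {o o' : L} (h : o ≠ o')
    (ha : a o' = T.bar (a o)) {σ : Finset L → ℝ} (hσ : σ (restLegs o o') = 0)
    {G : Finset (Finset L)} (hG : ∀ S ∈ G, S ⊂ restLegs o o') :
    T.diagramValueOfSq o a σ G + T.diagramValueOfSq o a σ (insert (restLegs o o') G) =
      T.reducedValue o o' a σ G := by
  have hR : restLegs o o' ∉ G := fun hm => ssubset_irrefl _ (hG _ hm)
  unfold diagramValueOfSq reducedValue
  rw [sum_insert_fun hR, ← Finset.sum_add_distrib]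
  refine Finset.sum_congr rfl fun τ _ => ?_
  rw [fieldsAt_erase a h hG τ]
  set Pr := ∏ S : G, (Complex.I / ((σ S.1 - T.mass (τ S) ^ 2 : ℝ) : ℂ)) *
        (-Complex.I * T.coupling (T.bar (τ S) ::ₘ fieldsAt a G τ S.1)) with hPr
  have key : ∀ e : Fin r,
      (-Complex.I * T.coupling (a o ::ₘ fieldsAt a (insert (restLegs o o') G)
          (fun U => ((Finset.subtypeInsertEquivOption hR) U).elim e τ) (Finset.univ.erase o))) *
      ∏ S : (insert (restLegs o o') G : Finset (Finset L)),
        (Complex.I / ((σ S.1 -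
          T.mass (((Finset.subtypeInsertEquivOption hR) S).elim e τ) ^ 2 : ℝ) : ℂ)) *
        (-Complex.I * T.coupling (T.bar (((Finset.subtypeInsertEquivOption hR) S).elim e τ) ::ₘ
          fieldsAt a (insert (restLegs o o') G)
          (fun U => ((Finset.subtypeInsertEquivOption hR) U).elim e τ) S.1)) =
      Complex.I * (T.coupling (a o ::ₘ T.bar (a o) ::ₘ {e}) *
        T.coupling (T.bar e ::ₘ fieldsAt a G τ (restLegs o o')) / ((T.mass e ^ 2 : ℝ) : ℂ)) *
        Pr := by
    intro e
    have hm : ((T.mass e ^ 2 : ℝ) : ℂ) ≠ 0 := by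
      exact_mod_cast (pow_pos (T.mass_pos e) 2).ne'
    rw [prod_insert_subtype hR, fieldsAt_insert_erase a h hG, elim_insert_self, hσ,
      fieldsAt_insert a _ (ssubset_irrefl _), ha]
    have h1 : (∏ S : G, (Complex.I / ((σ S.1 - T.mass (((Finset.subtypeInsertEquivOption hR)
          ⟨S.1, Finset.mem_insert_of_mem S.2⟩).elim e τ) ^ 2 : ℝ) : ℂ)) *
        (-Complex.I * T.coupling (T.bar (((Finset.subtypeInsertEquivOption hR)
          ⟨S.1, Finset.mem_insert_of_mem S.2⟩).elim e τ) ::ₘ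
          fieldsAt a (insert (restLegs o o') G)
          (fun U => ((Finset.subtypeInsertEquivOption hR) U).elim e τ) S.1))) = Pr := by
      rw [hPr]
      refine Finset.prod_congr rfl fun S _ => ?_
      rw [elim_insert_of_mem, fieldsAt_insert a _ (hG S.1 S.2).not_gt]
      simp only [elim_insert_of_mem]
    rw [h1]
    simp only [elim_insert_of_mem]
    rw [zero_sub, Complex.ofReal_neg]
    generalize ((T.mass e ^ 2 : ℝ) : ℂ) = M at hm
    field_simp
    rw [Complex.I_sq]
    ring
  rw [Finset.sum_congr rfl fun e _ => key e, ← Finset.sum_mul, ← Finset.mul_sum, ha,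
    forwardVertex]
  ring

/-- The diagrams without lines separating `o` from `o'`, paired up. -/
theorem sum_diagramValueOfSq (a : L → Fin r) {o o' : L} (h : o ≠ o')
    (ha : a o' = T.bar (a o)) {σ : Finset L → ℝ} (hσ : σ (restLegs o o') = 0)
    (hc : 2 ≤ (restLegs o o').card) :
    ∑ F : Finset (Finset L) with IsTreeDiagram o F ∧ ∀ S ∈ F, o' ∉ S,
        T.diagramValueOfSq o a σ F =
      ∑ G : Finset (Finset L) with IsTreeDiagram o G ∧ ∀ S ∈ G, S ⊂ restLegs o o',
        T.reducedValue o o' a σ G := by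
  have hsub : ∀ {F : Finset (Finset L)}, IsTreeDiagram o F → (∀ S ∈ F, o' ∉ S) →
      ∀ S ∈ F, S ⊆ restLegs o o' := fun hF hF' S hS x hx =>
    mem_restLegs.2 ⟨fun hx' => hF' S hS (hx' ▸ hx), fun hx' => (hF.1 S hS).1 (hx' ▸ hx)⟩
  have hR : ∀ {G : Finset (Finset L)}, (∀ S ∈ G, S ⊂ restLegs o o') → restLegs o o' ∉ G :=
    fun hG hm => ssubset_irrefl _ (hG _ hm)
  -- Split the diagrams according to whether `restLegs o o'` is one of their lines; erasing it is a
  -- bijection onto those without it.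
  rw [Finset.sum_congr rfl fun G hG => (T.diagramValueOfSq_add_insert a h ha hσ
    (Finset.mem_filter.1 hG).2.2).symm, Finset.sum_add_distrib,
    ← Finset.sum_filter_not_add_sum_filter _ (fun F => restLegs o o' ∈ F)]
  congr 1
  · refine Finset.sum_congr ?_ fun _ _ => rfl
    ext F
    simp only [Finset.mem_filter, Finset.mem_univ, true_and]
    constructor
    · rintro ⟨⟨h1, h2⟩, h3⟩
      exact ⟨h1, fun S hS => (hsub h1 h2 S hS).ssubset_of_ne fun h => h3 (h ▸ hS)⟩
    · rintro ⟨h1, h2⟩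
      exact ⟨⟨h1, fun S hS hx => (mem_restLegs.1 ((h2 S hS).subset hx)).1 rfl⟩, hR h2⟩
  · symm
    refine Finset.sum_bij (fun G _ => insert (restLegs o o') G) ?_ ?_ ?_ (fun _ _ => rfl)
    · intro G hG
      obtain ⟨h1, h2⟩ := (Finset.mem_filter.1 hG).2
      simp only [Finset.mem_filter, Finset.mem_univ, true_and, Finset.mem_insert_self, and_true]
      refine ⟨⟨?_, ?_⟩, ?_⟩
      · intro S hS
        rcases Finset.mem_insert.1 hS with rfl | hS
        · exact ⟨fun hx => (mem_restLegs.1 hx).2 rfl, hc, (card_restLegs h).le⟩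
        · exact h1.1 S hS
      · intro S hS U hU
        rcases Finset.mem_insert.1 hS with rfl | hS
        · rcases Finset.mem_insert.1 hU with rfl | hU
          · exact Or.inl subset_rfl
          · exact Or.inr (Or.inl (h2 U hU).subset)
        · rcases Finset.mem_insert.1 hU with rfl | hU
          · exact Or.inl (h2 S hS).subset
          · exact h1.2 S hS U hU
      · intro S hS hx
        rcases Finset.mem_insert.1 hS with rfl | hS
        · exact (mem_restLegs.1 hx).1 rfl
        · exact (mem_restLegs.1 ((h2 S hS).subset hx)).1 rfl
    · intro G hG G' hG' heq
      rw [← Finset.erase_insert (hR (Finset.mem_filter.1 hG).2.2), heq,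
        Finset.erase_insert (hR (Finset.mem_filter.1 hG').2.2)]
    · intro F hF
      simp only [Finset.mem_filter, Finset.mem_univ, true_and] at hF
      obtain ⟨⟨h1, h2⟩, h3⟩ := hF
      refine ⟨F.erase (restLegs o o'), ?_, Finset.insert_erase h3⟩
      simp only [Finset.mem_filter, Finset.mem_univ, true_and]
      exact ⟨⟨fun S hS => h1.1 S (Finset.mem_of_mem_erase hS), fun S hS U hU =>
        h1.2 S (Finset.mem_of_mem_erase hS) U (Finset.mem_of_mem_erase hU)⟩, fun S hS =>
        (hsub h1 h2 S (Finset.mem_of_mem_erase hS)).ssubset_of_ne (Finset.ne_of_mem_erase hS)⟩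

end Pairing
-- Counting fields at vertices and the diagrams that vanish
section Vanishing

variable {L : Type} [Fintype L] [DecidableEq L] {r : ℕ}

theorem card_fieldsAt (a : L → Fin r) (F : Finset (Finset L)) (τ : F → Fin r) (S : Finset L) :
    (fieldsAt a F τ S).card = (legsAt F S).card + (linesAt F S).card := by
  simp [fieldsAt]

theorem mem_linesAt {F : Finset (Finset L)} {S : Finset L} {U : F} :
    U ∈ linesAt F S ↔ U.1 ⊂ S ∧ ∀ V ∈ F, U.1 ⊂ V → ¬ V ⊂ S := by
  simp [linesAt]

theorem exists_mem_linesAt {F : Finset (Finset L)} {S U : Finset L} (hU : U ∈ F) (hUS : U ⊂ S) :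
    ∃ V ∈ linesAt F S, U ⊆ V.1 := by
  obtain ⟨V, hV, hmax⟩ := Finset.exists_max_image (F.filter fun V => V ⊂ S ∧ U ⊆ V) Finset.card
    ⟨U, by simp [hU, hUS]⟩
  obtain ⟨h1, h2, h3⟩ := Finset.mem_filter.1 hV
  refine ⟨⟨V, h1⟩, mem_linesAt.2 ⟨h2, fun W hW hVW hWS => ?_⟩, h3⟩
  exact (Finset.card_lt_card hVW).not_ge
    (hmax W (Finset.mem_filter.2 ⟨hW, hWS, h3.trans hVW.subset⟩))

theorem mem_legsAt_or (F : Finset (Finset L)) {S : Finset L} {x : L} (hx : x ∈ S) :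
    x ∈ legsAt F S ∨ ∃ V ∈ linesAt F S, x ∈ V.1 := by
  by_cases h : ∃ U ∈ F, U ⊂ S ∧ x ∈ U
  · obtain ⟨U, hU, hUS, hxU⟩ := h
    obtain ⟨V, hV, hUV⟩ := exists_mem_linesAt hU hUS
    exact Or.inr ⟨V, hV, hUV hxU⟩
  · refine Or.inl (Finset.mem_filter.2 ⟨hx, fun U hU hUS hxU => h ⟨U, hU, hUS, hxU⟩⟩)

theorem disjoint_linesAt {o : L} {F : Finset (Finset L)} (hF : IsTreeDiagram o F) {S : Finset L}
    {U V : F} (hU : U ∈ linesAt F S) (hV : V ∈ linesAt F S) (h : U ≠ V) : Disjoint U.1 V.1 := by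
  rw [mem_linesAt] at hU hV
  have h' : U.1 ≠ V.1 := fun h' => h (Subtype.ext h')
  rcases hF.2 U.1 U.2 V.1 V.2 with h1 | h1 | h1
  · exact absurd hV.1 (hU.2 V.1 V.2 (h1.ssubset_of_ne h'))
  · exact absurd hU.1 (hV.2 U.1 U.2 (h1.ssubset_of_ne h'.symm))
  · exact h1

/-- The legs at `S` and the parts cut off by its outgoing lines are disjoint subsets of `S`, and
each such part has at least two legs. -/
theorem card_legsAt_add_le {o : L} {F : Finset (Finset L)} (hF : IsTreeDiagram o F)
    (S : Finset L) :
    (legsAt F S).card + 2 * (linesAt F S).card ≤ S.card := by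
  have h1 : ((linesAt F S).biUnion fun U => U.1).card = ∑ U ∈ linesAt F S, U.1.card :=
    Finset.card_biUnion fun U hU V hV h => disjoint_linesAt hF hU hV h
  have h2 : (linesAt F S).card • 2 ≤ ∑ U ∈ linesAt F S, U.1.card :=
    Finset.card_nsmul_le_sum _ _ _ fun U _ => (hF.1 U.1 U.2).2.1
  have h3 : Disjoint (legsAt F S) ((linesAt F S).biUnion fun U => U.1) := by
    rw [Finset.disjoint_left]
    intro x hx hx'
    obtain ⟨U, hU, hxU⟩ := Finset.mem_biUnion.1 hx'
    exact (Finset.mem_filter.1 hx).2 U.1 U.2 (mem_linesAt.1 hU).1 hxU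
  have h4 : legsAt F S ∪ ((linesAt F S).biUnion fun U => U.1) ⊆ S := by
    refine Finset.union_subset (Finset.filter_subset _ _) (Finset.biUnion_subset.2 fun U hU => ?_)
    exact (mem_linesAt.1 hU).1.subset
  have h5 := Finset.card_le_card h4
  rw [Finset.card_union_of_disjoint h3, h1] at h5
  rw [smul_eq_mul] at h2
  omega

/-- A line leaving `S` cuts off a proper part, so some leg of `S` is left over and needs a further
leg or line at this vertex. -/
theorem two_le_card_fieldsAt (a : L → Fin r) (F : Finset (Finset L)) (τ : F → Fin r)
    {S : Finset L} (hS : 2 ≤ S.card) : 2 ≤ (fieldsAt a F τ S).card := by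
  rw [card_fieldsAt]
  rcases (linesAt F S).eq_empty_or_nonempty with h | ⟨U, hU⟩
  · have : S ⊆ legsAt F S := fun x hx => by simpa [h] using mem_legsAt_or F hx
    have := Finset.card_le_card this
    omega
  · obtain ⟨x, hx, hxU⟩ := Finset.exists_of_ssubset (mem_linesAt.1 hU).1
    rcases mem_legsAt_or F hx with h | ⟨V, hV, hxV⟩
    · have h1 := Finset.card_pos.2 ⟨x, h⟩
      have h2 := Finset.card_pos.2 ⟨U, hU⟩
      omega
    · have : 1 < (linesAt F S).card :=
        Finset.one_lt_card.2 ⟨U, hU, V, hV, fun h => hxU (h ▸ hxV)⟩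
      omega

/-- All fields in `s` have the same value of `g`. -/
def Uniform (g : Fin r → ℂ) (s : Multiset (Fin r)) : Prop :=
  ∀ a ∈ s, ∀ b ∈ s, g a = g b

theorem exists_mem_fieldsAt {g : Fin r → ℂ} {a : L → Fin r} {F : Finset (Finset L)}
    {τ : F → Fin r} {S : Finset L}
    (h : ∀ U : F, U.1 ⊂ S → ∀ x ∈ U.1, g (a x) = g (τ U)) {x : L} (hx : x ∈ S) :
    ∃ b ∈ fieldsAt a F τ S, g (a x) = g b := by
  rcases mem_legsAt_or F hx with hx | ⟨V, hV, hxV⟩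
  · exact ⟨a x, Multiset.mem_add.2 (Or.inl (Multiset.mem_map_of_mem a hx)), rfl⟩
  · exact ⟨τ V, Multiset.mem_add.2 (Or.inr (Multiset.mem_map_of_mem τ hV)),
      h V (mem_linesAt.1 hV).1 x hxV⟩

/-- Uniformity at each vertex carries the value of `g` from the external legs inward, by induction
on the number of legs cut off by the line. -/
theorem leg_eq_line (T : ScalarTheory r) {g : Fin r → ℂ} (hg : ∀ b, g (T.bar b) = g b)
    {a : L → Fin r} {F : Finset (Finset L)} {τ : F → Fin r}
    (h : ∀ U : F, Uniform g (T.bar (τ U) ::ₘ fieldsAt a F τ U.1)) :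
    ∀ U : F, ∀ x ∈ U.1, g (a x) = g (τ U) := by
  have key : ∀ n, ∀ U : F, U.1.card < n → ∀ x ∈ U.1, g (a x) = g (τ U) := by
    intro n
    induction n with
    | zero => intro U hU; omega
    | succ n ih =>
      intro U hU x hx
      obtain ⟨b, hb, hb'⟩ := exists_mem_fieldsAt (τ := τ) (fun V hV y hy =>
        ih V (lt_of_lt_of_le (Finset.card_lt_card hV) (Nat.lt_succ_iff.1 hU)) y hy) hx
      rw [hb', ← hg (τ U)]
      exact h U b (Multiset.mem_cons_of_mem hb) _ (Multiset.mem_cons_self _ _)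
  exact fun U => key _ U (Nat.lt_succ_self _)

/-- If all vertices with nonzero value are uniform, so are the legs of a diagram with nonzero
value. -/
theorem reducedValue_eq_zero (T : ScalarTheory r) {g : Fin r → ℂ} (hg : ∀ b, g (T.bar b) = g b)
    {o o' : L} {a : L → Fin r} (σ : Finset L → ℝ) {G : Finset (Finset L)}
    (hroot : ∀ τ : G → Fin r, T.forwardVertex (a o) (fieldsAt a G τ (restLegs o o')) ≠ 0 →
      Uniform g (fieldsAt a G τ (restLegs o o')))
    (hvert : ∀ (τ : G → Fin r) (S : G), T.coupling (T.bar (τ S) ::ₘ fieldsAt a G τ S.1) ≠ 0 →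
      Uniform g (T.bar (τ S) ::ₘ fieldsAt a G τ S.1))
    (hmix : ¬ Uniform g ((restLegs o o').val.map a)) :
    T.reducedValue o o' a σ G = 0 := by
  refine Finset.sum_eq_zero fun τ _ => ?_
  by_contra hne
  obtain ⟨h1, h2⟩ := mul_ne_zero_iff.1 hne
  have h1 := hroot τ (mul_ne_zero_iff.1 h1).2
  have h2 : ∀ S : G, Uniform g (T.bar (τ S) ::ₘ fieldsAt a G τ S.1) := fun S =>
    hvert τ S (mul_ne_zero_iff.1 (mul_ne_zero_iff.1 (Finset.prod_ne_zero_iff.1 h2 S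
      (Finset.mem_univ S))).2).2
  have h3 := leg_eq_line T hg h2
  refine hmix fun b hb b' hb' => ?_
  obtain ⟨x, hx, rfl⟩ := Multiset.mem_map.1 hb
  obtain ⟨y, hy, rfl⟩ := Multiset.mem_map.1 hb'
  obtain ⟨c, hc, hc'⟩ := exists_mem_fieldsAt (τ := τ) (fun U _ => h3 U) hx
  obtain ⟨d, hd, hd'⟩ := exists_mem_fieldsAt (τ := τ) (fun U _ => h3 U) hy
  rw [hc', hd']
  exact h1 c hc d hd

/-- A diagram with at least one line vanishes if its legs are not uniform but all smaller vertices
are, unless its only line cuts off a single leg. -/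
theorem reducedValue_eq_zero_of_card (T : ScalarTheory r) {g : Fin r → ℂ}
    (hg : ∀ b, g (T.bar b) = g b) {o o' : L} {a : L → Fin r} (σ : Finset L → ℝ)
    (hV : ∀ s : Multiset (Fin r), 3 ≤ s.card → s.card < (restLegs o o').card →
      T.coupling s ≠ 0 → Uniform g s)
    (hW : ∀ s : Multiset (Fin r), 2 ≤ s.card → s.card < (restLegs o o').card →
      T.forwardVertex (a o) s ≠ 0 → Uniform g s)
    (hmix : ¬ Uniform g ((restLegs o o').val.map a))
    (hc : 2 ≤ (restLegs o o').card)
    {G : Finset (Finset L)} (hG : IsTreeDiagram o G) (hG' : ∀ S ∈ G, S ⊂ restLegs o o')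
    (hne : G.Nonempty) (hG'' : ∀ x ∈ restLegs o o', G ≠ {(restLegs o o').erase x}) :
    T.reducedValue o o' a σ G = 0 := by
  -- Each line leaving a vertex replaces at least two legs by one field.
  have hlt : ∀ S, (∃ U ∈ G, U ⊂ S) → ∀ τ : G → Fin r, (fieldsAt a G τ S).card + 1 ≤ S.card := by
    rintro S ⟨U, hU, hUS⟩ τ
    obtain ⟨V, hV, -⟩ := exists_mem_linesAt hU hUS
    have h1 := Finset.card_pos.2 ⟨V, hV⟩
    have h2 := card_legsAt_add_le hG S
    rw [card_fieldsAt]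
    omega
  refine T.reducedValue_eq_zero hg σ (fun τ => hW _ (two_le_card_fieldsAt a G τ hc) ?_)
    (fun τ S => hV _ ?_ ?_) hmix
  · obtain ⟨S, hS⟩ := hne
    exact hlt _ ⟨S, hS, hG' S hS⟩ τ
  · have := two_le_card_fieldsAt a G τ (hG.1 S.1 S.2).2.1
    rw [Multiset.card_cons]
    omega
  · rw [Multiset.card_cons]
    have hS := Finset.card_lt_card (hG' S.1 S.2)
    -- The borderline case: a vertex with no lines below it that gathers all legs but one would have
    -- as many fields as the whole process. A second line must then lie strictly below it, since it
    -- is too small to be disjoint and too large to contain it.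
    by_cases hS' : S.1.card + 1 = (restLegs o o').card
    · suffices ∃ U ∈ G, U ⊂ S.1 by
        have := hlt S.1 this τ
        omega
      obtain ⟨x, hx, hxS⟩ := Finset.exists_of_ssubset (hG' S.1 S.2)
      have hSx : S.1 = (restLegs o o').erase x := by
        refine Finset.eq_of_subset_of_card_le (fun y hy => Finset.mem_erase.2
          ⟨fun h => hxS (h ▸ hy), (hG' S.1 S.2).subset hy⟩) ?_
        rw [Finset.card_erase_of_mem hx]
        omega
      obtain ⟨U, hU, hUS⟩ : ∃ U ∈ G, U ≠ S.1 := by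
        by_contra! h
        refine hG'' x hx (hSx ▸ Finset.eq_singleton_iff_unique_mem.2 ⟨S.2, h⟩)
      refine ⟨U, hU, ?_⟩
      have hU2 := (hG.1 U hU).2.1
      rcases hG.2 U hU S.1 S.2 with h | h | h
      · exact h.ssubset_of_ne hUS
      · have h1 := Finset.card_lt_card (h.ssubset_of_ne hUS.symm)
        have h2 := Finset.card_lt_card (hG' U hU)
        omega
      · have h1 := Finset.card_le_card
          (Finset.union_subset (hG' U hU).subset (hG' S.1 S.2).subset)
        rw [Finset.card_union_of_disjoint h] at h1
        omega
    · have h2 := card_legsAt_add_le hG S.1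
      rw [card_fieldsAt]
      omega

theorem reducedValue_empty (T : ScalarTheory r) (o o' : L) (a : L → Fin r) (σ : Finset L → ℝ) :
    T.reducedValue o o' a σ ∅ =
      -Complex.I * T.forwardVertex (a o) ((restLegs o o').val.map a) := by
  unfold reducedValue
  rw [Fintype.sum_unique, Fintype.prod_empty, mul_one]
  congr 2
  simp [fieldsAt, legsAt, linesAt]

/-- The two-field root vertex forces the line to have type `bar (a x)`. Its far end is then a field
of type `a x`, which restores the missing leg, so the other vertex is the full coupling. -/
theorem reducedValue_singleton (T : ScalarTheory r) (o o' : L) (a : L → Fin r)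
    (σ : Finset L → ℝ) {x : L} (hx : x ∈ restLegs o o')
    (hW : ∀ e, e ≠ T.bar (a x) → T.forwardVertex (a o) {a x, e} = 0) :
    T.reducedValue o o' a σ {(restLegs o o').erase x} =
      -Complex.I * T.forwardVertex (a o) {a x, T.bar (a x)} *
        T.coupling ((restLegs o o').val.map a) /
          ((σ ((restLegs o o').erase x) - T.mass (a x) ^ 2 : ℝ) : ℂ) := by
  set S := (restLegs o o').erase x with hS
  have hSR : S ⊂ restLegs o o' := Finset.erase_ssubset hx
  have hroot : ∀ τ : ↥({S} : Finset (Finset L)) → Fin r,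
      fieldsAt a {S} τ (restLegs o o') = {a x, τ default} := by
    intro τ
    have h1 : legsAt {S} (restLegs o o') = {x} := by
      ext y
      simp only [legsAt, Finset.mem_filter, Finset.mem_singleton, forall_eq, hS, Finset.mem_erase]
      constructor
      · rintro ⟨h1, h2⟩
        by_contra h
        exact h2 hSR ⟨h, h1⟩
      · rintro rfl
        exact ⟨hx, fun _ h => h.1 rfl⟩
    have h2 : linesAt {S} (restLegs o o') = {default} := by
      ext U
      rw [Unique.eq_default U, mem_linesAt]
      simp [hSR]
    unfold fieldsAt
    rw [h1, h2]
    rfl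
  have hvert : ∀ τ : ↥({S} : Finset (Finset L)) → Fin r, fieldsAt a {S} τ S = S.val.map a := by
    intro τ
    have h1 : legsAt {S} S = S := by
      ext y
      simp [legsAt]
    have h2 : linesAt {S} S = ∅ := by
      ext U
      rw [Unique.eq_default U, mem_linesAt]
      simp
    unfold fieldsAt
    rw [h1, h2]
    simp
  have hM : a x ::ₘ S.val.map a = (restLegs o o').val.map a := by
    rw [← Multiset.map_cons, hS, Finset.erase_val, Multiset.cons_erase hx]
  unfold reducedValue
  rw [Fintype.sum_eq_single (fun _ => T.bar (a x))]
  · rw [Fintype.prod_unique, hroot]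
    change _ * (Complex.I / ((σ S - T.mass (T.bar (a x)) ^ 2 : ℝ) : ℂ) *
      (-Complex.I * T.coupling (T.bar (T.bar (a x)) ::ₘ fieldsAt a {S} _ S))) = _
    rw [hvert, T.bar_bar, hM, T.mass_bar]
    linear_combination (-Complex.I * T.forwardVertex (a o) {a x, T.bar (a x)} *
      T.coupling ((restLegs o o').val.map a) /
          ((σ S - T.mass (a x) ^ 2 : ℝ) : ℂ)) * (-Complex.I_sq)
  · intro τ hτ
    have : τ default ≠ T.bar (a x) := fun h => hτ (funext fun U => by
      rw [Unique.eq_default U, h])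
    rw [hroot, hW _ this]
    simp

/-- The sum of all diagrams when there are just two legs besides `o` and `o'`. -/
theorem sum_reducedValue_two (T : ScalarTheory r) {o o' : L} (a : L → Fin r) (σ : Finset L → ℝ)
    (hc : (restLegs o o').card = 2) :
    ∑ G : Finset (Finset L) with IsTreeDiagram o G ∧ ∀ S ∈ G, S ⊂ restLegs o o',
        T.reducedValue o o' a σ G =
      -Complex.I * T.forwardVertex (a o) ((restLegs o o').val.map a) := by
  rw [← reducedValue_empty T o o' a σ]
  refine Finset.sum_eq_single ∅ (fun G hG hne => ?_) (fun h => ?_)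
  · obtain ⟨h1, h2⟩ := (Finset.mem_filter.1 hG).2
    obtain ⟨S, hS⟩ := Finset.nonempty_iff_ne_empty.2 hne
    have := Finset.card_lt_card (h2 S hS)
    have := (h1.1 S hS).2.1
    omega
  · exact absurd (Finset.mem_filter.2 ⟨Finset.mem_univ _, by simp [IsTreeDiagram], by simp⟩) h

/-- The sum of all diagrams when the legs are not uniform but all smaller vertices are. -/
theorem sum_reducedValue (T : ScalarTheory r) {g : Fin r → ℂ}
    (hg : ∀ b, g (T.bar b) = g b) {o o' : L} {a : L → Fin r} (σ : Finset L → ℝ) (h : o ≠ o')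
    (hV : ∀ s : Multiset (Fin r), 3 ≤ s.card → s.card < (restLegs o o').card →
      T.coupling s ≠ 0 → Uniform g s)
    (hW : ∀ s : Multiset (Fin r), 2 ≤ s.card → s.card < (restLegs o o').card →
      T.forwardVertex (a o) s ≠ 0 → Uniform g s)
    (hW₂ : ∀ b e, e ≠ T.bar b → T.forwardVertex (a o) {b, e} = 0)
    (hmix : ¬ Uniform g ((restLegs o o').val.map a))
    (hc : 3 ≤ (restLegs o o').card) :
    ∑ G : Finset (Finset L) with IsTreeDiagram o G ∧ ∀ S ∈ G, S ⊂ restLegs o o',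
        T.reducedValue o o' a σ G =
      -Complex.I * T.forwardVertex (a o) ((restLegs o o').val.map a) +
        ∑ x ∈ restLegs o o', -Complex.I * T.forwardVertex (a o) {a x, T.bar (a x)} *
        T.coupling ((restLegs o o').val.map a) /
          ((σ ((restLegs o o').erase x) - T.mass (a x) ^ 2 : ℝ) : ℂ) := by
  have hinj : Set.InjOn (fun x => ({(restLegs o o').erase x} : Finset (Finset L)))
      (restLegs o o') := by
    intro x hx y hy hxy
    have hxy : (restLegs o o').erase x = (restLegs o o').erase y :=
      Finset.singleton_injective hxy
    by_contra hne
    have : x ∈ (restLegs o o').erase y := Finset.mem_erase.2 ⟨hne, hx⟩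
    rw [← hxy] at this
    simp at this
  have hnot : ∅ ∉ (restLegs o o').image
      (fun x => ({(restLegs o o').erase x} : Finset (Finset L))) := by simp
  rw [← reducedValue_empty T o o' a σ, ← Finset.sum_congr rfl fun x hx =>
    reducedValue_singleton T o o' a σ hx (hW₂ (a x)),
    ← Finset.sum_image (f := fun G => T.reducedValue o o' a σ G) hinj,
    ← Finset.sum_insert hnot]
  refine (Finset.sum_subset ?_ ?_).symm
  · intro G hG
    simp only [Finset.mem_filter, Finset.mem_univ, true_and]
    rcases Finset.mem_insert.1 hG with rfl | hG
    · simp [IsTreeDiagram]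
    · obtain ⟨x, hx, rfl⟩ := Finset.mem_image.1 hG
      have h1 := Finset.card_erase_of_mem hx
      have h2 := card_restLegs h
      refine ⟨⟨?_, ?_⟩, ?_⟩
      · intro S hS
        rw [Finset.mem_singleton] at hS
        subst hS
        refine ⟨fun ho => (mem_restLegs.1 (Finset.mem_of_mem_erase ho)).2 rfl, ?_, ?_⟩ <;> omega
      · intro S hS U hU
        rw [Finset.mem_singleton] at hS hU
        exact Or.inl (hS.trans hU.symm).subset
      · intro S hS
        rw [Finset.mem_singleton] at hS
        rw [hS]
        exact Finset.erase_ssubset hx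
  · intro G hG hG'
    obtain ⟨h1, h2⟩ := (Finset.mem_filter.1 hG).2
    rw [Finset.mem_insert, not_or] at hG'
    refine T.reducedValue_eq_zero_of_card hg σ hV hW hmix (by omega) h1 h2
      (Finset.nonempty_iff_ne_empty.2 hG'.1) fun x hx hGx => hG'.2 ?_
    exact Finset.mem_image.2 ⟨x, hx, hGx.symm⟩

end Vanishing
-- Amplitudes in the forward limit
section Forward

variable {L : Type} [Fintype L] [DecidableEq L] {r : ℕ}

theorem msq_neg (P : ℝ × ℝ) : msq (-P) = msq P := by
  simp [msq]

/-- Kinematics in which the legs `o` and `o'` become infinitely fast with finite momentum transfer,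
while the momenta of the other legs tend to `P`. -/
structure ForwardLimit (T : ScalarTheory r) {ι : Type*} (l : Filter ι) (o o' : L)
    (p : ι → L → ℝ × ℝ) (P : L → ℝ × ℝ) : Prop where
  ne : o ≠ o'
  conserved : ∀ n, ∑ x, p n x = 0
  tendsto_fst : Tendsto (fun n => |(p n o').1|) l atTop
  tendsto_snd : Tendsto (fun n => (p n o').2) l (𝓝 0)
  tendsto_rest : ∀ x ∈ restLegs o o', Tendsto (fun n => p n x) l (𝓝 (P x))
  sum_snd : ∑ x ∈ restLegs o o', (P x).2 = 0
  sum_snd_ne : ∀ U ⊂ restLegs o o', U.Nonempty → ∑ x ∈ U, (P x).2 ≠ 0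
  msq_ne : ∀ U ⊂ restLegs o o', 2 ≤ U.card → ∀ e, msq (∑ x ∈ U, P x) ≠ T.mass e ^ 2

namespace ForwardLimit

variable {T : ScalarTheory r} {ι : Type*} {l : Filter ι} {o o' : L}
  {p : ι → L → ℝ × ℝ} {P : L → ℝ × ℝ}

theorem tendsto_sum (h : T.ForwardLimit l o o' p P) {S : Finset L} (hS : S ⊆ restLegs o o') :
    Tendsto (fun n => ∑ x ∈ S, p n x) l (𝓝 (∑ x ∈ S, P x)) :=
  tendsto_finsetSum _ fun x hx => h.tendsto_rest x (hS hx)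

theorem tendsto_msq (h : T.ForwardLimit l o o' p P) {S : Finset L} (hS : S ⊆ restLegs o o') :
    Tendsto (fun n => msq (∑ x ∈ S, p n x)) l (𝓝 (msq (∑ x ∈ S, P x))) :=
  ((continuous_fst.mul continuous_snd).tendsto _).comp (h.tendsto_sum hS)

/-- The first light-cone component diverges because of the fast leg. The second tends to the partial
sum over the slow legs in `S`, a nonempty proper subset because of the bounds on the cardinality, so
it stays away from zero. -/
theorem tendsto_abs_msq (h : T.ForwardLimit l o o' p P) {S : Finset L} (ho : o ∉ S)
    (ho' : o' ∈ S) (hS : 2 ≤ S.card) (hS' : S.card + 2 ≤ Fintype.card L) :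
    Tendsto (fun n => |msq (∑ x ∈ S, p n x)|) l atTop := by
  have hsub : S.erase o' ⊆ restLegs o o' := fun _ hx => by
    rw [Finset.mem_erase] at hx
    exact mem_restLegs.2 ⟨hx.1, fun hxo => ho (hxo ▸ hx.2)⟩
  have hcard := Finset.card_erase_of_mem ho'
  have hcR := card_restLegs h.ne
  have hss : S.erase o' ⊂ restLegs o o' := hsub.ssubset_of_ne fun he => by
    rw [he] at hcard
    omega
  have hne : (S.erase o').Nonempty := Finset.card_pos.1 (by omega)
  have h1 : Tendsto (fun n => ∑ x ∈ S.erase o', p n x) l (𝓝 (∑ x ∈ S.erase o', P x)) :=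
    h.tendsto_sum hsub
  have hf : Tendsto (fun n => |(p n o').1 + (∑ x ∈ S.erase o', p n x).1|) l atTop := by
    have h2 := ((continuous_fst.tendsto _).comp h1).abs.neg
    refine tendsto_atTop_mono (fun n => ?_) (h.tendsto_fst.atTop_add h2)
    have := abs_sub_abs_le_abs_sub (p n o').1 (-(∑ x ∈ S.erase o', p n x).1)
    rw [abs_neg, sub_neg_eq_add] at this
    simp only [Function.comp]
    linarith
  have hs : Tendsto (fun n => |(p n o').2 + (∑ x ∈ S.erase o', p n x).2|) l
      (𝓝 |0 + (∑ x ∈ S.erase o', P x).2|) :=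
    (h.tendsto_snd.add ((continuous_snd.tendsto _).comp h1)).abs
  have hpos : 0 < |0 + (∑ x ∈ S.erase o', P x).2| := by
    rw [zero_add, abs_pos, Prod.snd_sum]
    exact h.sum_snd_ne _ hss hne
  refine (hf.atTop_mul_pos hpos hs).congr fun n => ?_
  rw [← Finset.add_sum_erase S _ ho', msq, abs_mul]
  rfl

theorem msq_ne' (h : T.ForwardLimit l o o' p P) {S : Finset L} (hS : S ⊆ restLegs o o')
    (hc : 2 ≤ S.card) (e : Fin r) : msq (∑ x ∈ S, P x) ≠ T.mass e ^ 2 := by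
  rcases hS.eq_or_ssubset with rfl | hS
  · rw [msq, Prod.snd_sum, h.sum_snd, mul_zero]
    exact (pow_pos (T.mass_pos e) 2).ne
  · exact h.msq_ne S hS hc e

theorem subset_restLegs {S : Finset L} (ho : o ∉ S) (ho' : o' ∉ S) : S ⊆ restLegs o o' :=
  fun _ hx => mem_restLegs.2 ⟨fun hx' => ho' (hx' ▸ hx), fun hx' => ho (hx' ▸ hx)⟩

/-- Elasticity is only assumed away from singular propagators. Squared momenta either diverge or
tend to values off the mass shells, and there are finitely many of them. -/
theorem eventually_nonsingular (h : T.ForwardLimit l o o' p P) :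
    ∀ᶠ n in l, T.Nonsingular (p n) := by
  have key : ∀ S : Finset L, o ∉ S → ∀ e : Fin r, ∀ᶠ n in l, 2 ≤ S.card →
      S.card + 2 ≤ Fintype.card L → msq (∑ x ∈ S, p n x) ≠ T.mass e ^ 2 := by
    intro S ho e
    by_cases hc : 2 ≤ S.card
    swap
    · exact Eventually.of_forall fun _ h => absurd h hc
    by_cases hc' : S.card + 2 ≤ Fintype.card L
    swap
    · exact Eventually.of_forall fun _ _ h => absurd h hc'
    by_cases ho' : o' ∈ S
    · filter_upwards [(h.tendsto_abs_msq ho ho' hc hc').eventually_gt_atTop (T.mass e ^ 2)]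
        with n hn _ _ heq
      rw [heq, abs_of_nonneg (sq_nonneg _)] at hn
      exact lt_irrefl _ hn
    · have hS := subset_restLegs ho ho'
      filter_upwards [(h.tendsto_msq hS).eventually_ne (h.msq_ne' hS hc e)] with n hn _ _ using hn
  have key' : ∀ᶠ n in l, ∀ S : Finset L, ∀ e : Fin r, o ∉ S → 2 ≤ S.card →
      S.card + 2 ≤ Fintype.card L → msq (∑ x ∈ S, p n x) ≠ T.mass e ^ 2 := by
    rw [eventually_all]
    intro S
    rw [eventually_all]
    intro e
    by_cases ho : o ∈ S
    · exact Eventually.of_forall fun _ h => absurd ho h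
    · filter_upwards [key S ho e] with n hn _ using hn
  filter_upwards [key'] with n hn S hc hc' e
  by_cases ho : o ∈ S
  -- By momentum conservation a part containing `o` has the same squared momentum as its complement.
  · have hsum : ∑ x ∈ S, p n x = -∑ x ∈ Sᶜ, p n x := by
      rw [eq_neg_iff_add_eq_zero, Finset.sum_add_sum_compl, h.conserved n]
    have hcard := Finset.card_add_card_compl S
    rw [hsum, msq_neg]
    exact hn Sᶜ e (by simpa using ho) (by omega) (by omega)
  · exact hn S e ho hc hc'

theorem tendsto_treeSum (h : T.ForwardLimit l o o' p P) {a : L → Fin r}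
    (ha : a o' = T.bar (a o)) (hc : 2 ≤ (restLegs o o').card) :
    Tendsto (fun n => T.treeSum o a (p n)) l
      (𝓝 (∑ G : Finset (Finset L) with IsTreeDiagram o G ∧ ∀ S ∈ G, S ⊂ restLegs o o',
        T.reducedValue o o' a (fun S => msq (∑ x ∈ S, P x)) G)) := by
  rw [← T.sum_diagramValueOfSq a h.ne ha ?_ hc]
  · exact ScalarTheory.tendsto_treeSum T o o' a p _ (fun S => h.tendsto_abs_msq)
      (fun S ho ho' => h.tendsto_msq (subset_restLegs ho ho'))
      (fun S ho ho' hc _ => h.msq_ne' (subset_restLegs ho ho') hc)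
  · rw [msq, Prod.snd_sum, h.sum_snd, mul_zero]

/-- With two slow legs, the amplitude tends to the forward vertex. -/
theorem tendsto_treeSum_two (h : T.ForwardLimit l o o' p P) {a : L → Fin r}
    (ha : a o' = T.bar (a o)) (hc : (restLegs o o').card = 2) :
    Tendsto (fun n => T.treeSum o a (p n)) l
      (𝓝 (-Complex.I * T.forwardVertex (a o) ((restLegs o o').val.map a))) := by
  rw [← sum_reducedValue_two T a (fun S => msq (∑ x ∈ S, P x)) hc]
  exact h.tendsto_treeSum ha hc.ge

/-- The relation between the forward vertex and the coupling of the same non-uniform fields that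
follows from the vanishing of the amplitude. -/
theorem forwardVertex_relation [l.NeBot] (h : T.ForwardLimit l o o' p P) {a : L → Fin r}
    (ha : a o' = T.bar (a o)) (hP : ∀ x ∈ restLegs o o', msq (P x) = T.mass (a x) ^ 2)
    {g : Fin r → ℂ} (hg : ∀ b, g (T.bar b) = g b)
    (hgW : ∀ b, T.forwardVertex (a o) {b, T.bar b} = g b * ((T.mass b ^ 2 : ℝ) : ℂ))
    (hV : ∀ s : Multiset (Fin r), 3 ≤ s.card → s.card < (restLegs o o').card →
      T.coupling s ≠ 0 → Uniform g s)
    (hW : ∀ s : Multiset (Fin r), 2 ≤ s.card → s.card < (restLegs o o').card →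
      T.forwardVertex (a o) s ≠ 0 → Uniform g s)
    (hW₂ : ∀ b e, e ≠ T.bar b → T.forwardVertex (a o) {b, e} = 0)
    (hmix : ¬ Uniform g ((restLegs o o').val.map a))
    (hc : 3 ≤ (restLegs o o').card)
    (hzero : ∀ᶠ n in l, T.treeSum o a (p n) = 0) :
    ∑ x ∈ restLegs o o', (T.forwardVertex (a o) ((restLegs o o').val.map a) -
      T.coupling ((restLegs o o').val.map a) * g (a x)) * (((P x).1 : ℝ) : ℂ) = 0 := by
  have h0 := tendsto_nhds_unique (h.tendsto_treeSum ha (by omega))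
    (tendsto_const_nhds.congr' (EventuallyEq.symm hzero))
  rw [sum_reducedValue T hg _ h.ne hV hW hW₂ hmix hc] at h0
  set R := restLegs o o' with hR
  set D := ∑ x ∈ R, (P x).1 with hD
  set W := T.forwardVertex (a o) (R.val.map a)
  set V := T.coupling (R.val.map a)
  have hx2 : ∀ x ∈ R, (P x).2 ≠ 0 := fun x hx h0 => by
    have := hP x hx
    rw [msq, h0, mul_zero] at this
    exact (pow_pos (T.mass_pos (a x)) 2).ne this
  -- The total is `(D, 0)`, so `(D - p.1) * (-p.2) - p.1 * p.2 = -D * p.2`.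
  have hσ : ∀ x ∈ R, msq (∑ y ∈ R.erase x, P y) - T.mass (a x) ^ 2 = -(D * (P x).2) := by
    intro x hx
    have h1 := Finset.sum_erase_eq_sub (f := P) hx
    rw [h1, ← hP x hx, msq, msq, Prod.fst_sub, Prod.snd_sub, Prod.fst_sum, Prod.snd_sum, h.sum_snd, ← hD]
    ring
  -- If `D` were zero, the legs other than `x` would have a total momentum on the mass shell of `a
  -- x`, which `msq_ne` excludes.
  have hDne : D ≠ 0 := by
    obtain ⟨x, hx⟩ : R.Nonempty := Finset.card_pos.1 (by omega)
    intro hD0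
    have h1 := hσ x hx
    rw [hD0, zero_mul, neg_zero, sub_eq_zero] at h1
    refine h.msq_ne _ (Finset.erase_ssubset hx) ?_ _ h1
    rw [Finset.card_erase_of_mem hx]
    omega
  have hDne' : (D : ℂ) ≠ 0 := by exact_mod_cast hDne
  have hterm : ∀ x ∈ R, -Complex.I * T.forwardVertex (a o) {a x, T.bar (a x)} * V /
      ((msq (∑ y ∈ R.erase x, P y) - T.mass (a x) ^ 2 : ℝ) : ℂ) =
      Complex.I * (V * g (a x) * ((P x).1 : ℂ)) / D := by
    intro x hx
    have h2 : ((P x).2 : ℂ) ≠ 0 := by exact_mod_cast hx2 x hx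
    rw [hgW, hσ x hx, ← hP x hx, msq]
    push_cast
    field_simp
  rw [Finset.sum_congr rfl hterm, ← Finset.sum_div, ← Finset.mul_sum] at h0
  have h3 : (D : ℂ) = ∑ x ∈ R, ((P x).1 : ℂ) := by rw [hD]; push_cast; rfl
  simp only [sub_mul]
  rw [Finset.sum_sub_distrib, ← Finset.mul_sum, ← h3]
  have h4 : Complex.I * (W * D - ∑ x ∈ R, V * g (a x) * ((P x).1 : ℂ)) = 0 := by
    field_simp at h0
    linear_combination -h0
  exact (mul_eq_zero.1 h4).resolve_left Complex.I_ne_zero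

end ForwardLimit

end Forward
-- Existence of fast processes with generic slow momenta
section Kinematics

/-- Two-particle kinematics: a fast particle of mass `m` and a particle of mass `m₀` can scatter into
a fast particle of mass `m` and a system with light-cone momentum `(Q, X)`. -/
theorem exists_fast_kinematics {m m₀ X : ℝ} (hm : 0 < m) (hm₀ : 0 < m₀) (hX : 0 < X) (Q : ℝ) :
    ∃ θ θ' α : ℕ → ℝ, Tendsto θ atTop atTop ∧ Tendsto θ' atTop atTop ∧
      Tendsto (fun n => m₀ * Real.exp (-α n)) atTop (𝓝 X) ∧
      (∀ n, m * Real.exp (θ n) + m₀ * Real.exp (α n) = m * Real.exp (θ' n) + Q) ∧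
      ∀ n, m * Real.exp (-θ n) + m₀ * Real.exp (-α n) = m * Real.exp (-θ' n) + X := by
  -- Here the slow system already balances by itself, and the fast particle keeps its momentum.
  by_cases hD : m₀ ^ 2 / X - Q = 0
  · have hα : m₀ * Real.exp (Real.log (X / m₀)) = X := by
      rw [Real.exp_log (div_pos hX hm₀)]
      field_simp
    have hα' : m₀ * Real.exp (-Real.log (X / m₀)) = Q := by
      rw [Real.exp_neg, Real.exp_log (div_pos hX hm₀), ← sub_eq_zero.1 hD]
      field_simp
    refine ⟨fun n => n, fun n => n, fun _ => -Real.log (X / m₀), tendsto_natCast_atTop_atTop,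
      tendsto_natCast_atTop_atTop, ?_, fun n => ?_, fun n => ?_⟩
    · simp only [neg_neg, hα]
      exact tendsto_const_nhds
    · rw [hα']
    · rw [neg_neg, hα]
  set D := m₀ ^ 2 / X - Q with hDdef
  have hn : Tendsto (fun n : ℕ => (n : ℝ)) atTop atTop := tendsto_natCast_atTop_atTop
  -- The slow incoming component `y` is perturbed from `X` by `D / n`. With `z = exp θ` and `z' =
  -- exp θ'`, conservation becomes `z' - z = d` and `m * (1 / z - 1 / z') = D / n`, that is `z * z'
  -- = q`. Solving the quadratic gives `(w ∓ d) / 2`. Since `d` tends to `D / m`, `q` grows like `n`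
  -- whatever the sign of `D`.
  set y : ℕ → ℝ := fun n => X - D / n with hy
  set d : ℕ → ℝ := fun n => (m₀ ^ 2 / y n - Q) / m with hd
  set q : ℕ → ℝ := fun n => m * d n / D * n with hq
  set w : ℕ → ℝ := fun n => √(d n ^ 2 + 4 * q n) with hw
  have hyX : Tendsto y atTop (𝓝 X) := by
    simpa using (hn.const_div_atTop D).const_sub X
  have hdD : Tendsto d atTop (𝓝 (D / m)) :=
    (((tendsto_const_nhds (x := m₀ ^ 2)).div hyX hX.ne').sub_const Q).div_const m
  have hq' : Tendsto q atTop atTop := by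
    have h1 : Tendsto (fun n => m * d n / D) atTop (𝓝 (m * (D / m) / D)) :=
      (hdD.const_mul m).div_const D
    have h2 : m * (D / m) / D = 1 := by field_simp
    rw [h2] at h1
    exact h1.pos_mul_atTop one_pos hn
  have hw' : Tendsto w atTop atTop :=
    Real.tendsto_sqrt_atTop.comp (tendsto_atTop_mono
      (fun n => by nlinarith [sq_nonneg (d n)]) (hq'.const_mul_atTop (by norm_num : (0:ℝ) < 4)))
  have hz : Tendsto (fun n => (w n - d n) / 2) atTop atTop :=
    (hw'.atTop_add hdD.neg).atTop_div_const two_pos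
  have hz' : Tendsto (fun n => (w n + d n) / 2) atTop atTop :=
    (hw'.atTop_add hdD).atTop_div_const two_pos
  have hev : ∀ᶠ n : ℕ in atTop, 0 < (n : ℝ) ∧ 0 < y n ∧ 0 < q n ∧ 0 < (w n - d n) / 2 ∧
      0 < (w n + d n) / 2 := by
    filter_upwards [hn.eventually_gt_atTop 0, hyX.eventually_const_lt hX,
      hq'.eventually_gt_atTop 0, hz.eventually_gt_atTop 0, hz'.eventually_gt_atTop 0]
      with n h1 h2 h3 h4 h5 using ⟨h1, h2, h3, h4, h5⟩
  -- Shifting by `k` makes the conservation laws hold for every index, not just eventually.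
  obtain ⟨k, hk⟩ := eventually_atTop.1 hev
  have hsh : Tendsto (fun n : ℕ => n + k) atTop atTop := tendsto_add_atTop_nat k
  have hα : ∀ n, m₀ * Real.exp (Real.log (y (n + k) / m₀)) = y (n + k) := fun n => by
    rw [Real.exp_log (div_pos (hk _ le_add_self).2.1 hm₀)]
    field_simp
  refine ⟨fun n => Real.log ((w (n + k) - d (n + k)) / 2),
    fun n => Real.log ((w (n + k) + d (n + k)) / 2), fun n => -Real.log (y (n + k) / m₀),
    Real.tendsto_log_atTop.comp (hz.comp hsh), Real.tendsto_log_atTop.comp (hz'.comp hsh),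
    ?_, fun n => ?_, fun n => ?_⟩
  · simp only [neg_neg, hα]
    exact hyX.comp hsh
  · obtain ⟨h1, h2, h3, h4, h5⟩ := hk (n + k) le_add_self
    rw [Real.exp_log h4, Real.exp_log h5, Real.exp_neg, Real.exp_log (div_pos h2 hm₀)]
    have : m * d (n + k) = m₀ ^ 2 / y (n + k) - Q := by
      rw [hd]
      field_simp
    have h6 : m₀ * (y (n + k) / m₀)⁻¹ = m₀ ^ 2 / y (n + k) := by field_simp
    rw [h6]
    linarith
  · obtain ⟨h1, h2, h3, h4, h5⟩ := hk (n + k) le_add_self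
    have hw2 : w (n + k) ^ 2 = d (n + k) ^ 2 + 4 * q (n + k) :=
      Real.sq_sqrt (by nlinarith [sq_nonneg (d (n + k))])
    have hprod : (w (n + k) - d (n + k)) / 2 * ((w (n + k) + d (n + k)) / 2) = q (n + k) := by
      linear_combination hw2 / 4
    rw [neg_neg, hα, Real.exp_neg, Real.exp_log h4, Real.exp_neg, Real.exp_log h5]
    have h6 : m * ((w (n + k) - d (n + k)) / 2)⁻¹ - m * ((w (n + k) + d (n + k)) / 2)⁻¹ =
        m * d (n + k) / q (n + k) := by
      rw [← hprod, inv_eq_one_div, inv_eq_one_div, ← mul_sub, div_sub_div _ _ h4.ne' h5.ne']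
      ring
    have hdne : d (n + k) ≠ 0 := fun h0 => by
      rw [hq] at h3
      simp [h0] at h3
    have h7 : m * d (n + k) / q (n + k) = D / ((n + k : ℕ) : ℝ) := by
      rw [hq]
      field_simp
    have h8 : y (n + k) = X - D / ((n + k : ℕ) : ℝ) := rfl
    rw [h7] at h6
    linarith

variable {K : ℕ}

/-- The slow legs of a process with two incoming and `K + 2` outgoing particles. -/
theorem restLegs_process : restLegs (Sum.inl 0 : Fin 2 ⊕ Fin (K + 2)) (Sum.inr 0) =
    insert (Sum.inl 1) (Finset.univ.image fun j : Fin (K + 1) => Sum.inr j.succ) := by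
  ext x
  rw [mem_restLegs]
  rcases x with x | x
  · fin_cases x <;> simp
  · cases x using Fin.cases <;> simp

theorem mem_restLegs_process {x : Fin 2 ⊕ Fin (K + 2)} :
    x ∈ restLegs (Sum.inl 0) (Sum.inr 0) ↔
      x = Sum.inl 1 ∨ ∃ j : Fin (K + 1), Sum.inr j.succ = x := by
  simp [restLegs_process]

theorem inr_succ_injective :
    Function.Injective fun j : Fin (K + 1) => (Sum.inr j.succ : Fin 2 ⊕ Fin (K + 2)) :=
  Sum.inr_injective.comp (Fin.succ_injective _)

theorem sum_restLegs {M : Type*} [AddCommMonoid M] (f : Fin 2 ⊕ Fin (K + 2) → M) :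
    ∑ x ∈ restLegs (Sum.inl 0) (Sum.inr 0), f x =
      f (Sum.inl 1) + ∑ j : Fin (K + 1), f (Sum.inr j.succ) := by
  rw [restLegs_process, Finset.sum_insert (by simp), Finset.sum_image inr_succ_injective.injOn]

theorem map_restLegs {β : Type*} (f : Fin 2 ⊕ Fin (K + 2) → β) :
    (restLegs (Sum.inl 0) (Sum.inr 0)).val.map f =
      f (Sum.inl 1) ::ₘ Finset.univ.val.map fun j : Fin (K + 1) => f (Sum.inr j.succ) := by
  rw [restLegs_process, Finset.insert_val_of_notMem (by simp), Multiset.map_cons,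
    Finset.image_val_of_injOn inr_succ_injective.injOn, Multiset.map_map]
  rfl

theorem card_restLegs_process :
    (restLegs (Sum.inl 0 : Fin 2 ⊕ Fin (K + 2)) (Sum.inr 0)).card = K + 2 := by
  have := card_restLegs (o := (Sum.inl 0 : Fin 2 ⊕ Fin (K + 2))) (o' := Sum.inr 0) (by simp)
  simp only [Fintype.card_sum, Fintype.card_fin] at this
  omega

theorem sum_subset_restLegs {M : Type*} [AddCommMonoid M] (f : Fin 2 ⊕ Fin (K + 2) → M)
    {U : Finset (Fin 2 ⊕ Fin (K + 2))} (hU : U ⊆ restLegs (Sum.inl 0) (Sum.inr 0)) :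
    ∑ x ∈ U, f x = (if Sum.inl 1 ∈ U then f (Sum.inl 1) else 0) +
      ∑ j : Fin (K + 1) with Sum.inr j.succ ∈ U, f (Sum.inr j.succ) := by
  rw [← Finset.inter_eq_right.2 hU, ← Finset.filter_mem_eq_inter, Finset.sum_filter,
    sum_restLegs]
  simp [Finset.sum_filter, mem_restLegs_process]

variable {r : ℕ} (T : ScalarTheory r)

/-- The limiting momenta of the slow legs: an incoming particle of type `c` and outgoing particles
of types `b j` with light-cone momenta `x j`. -/
noncomputable def slowMomentum (c : Fin r) (b : Fin (K + 1) → Fin r) (x : Fin (K + 1) → ℝ) :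
    Fin 2 ⊕ Fin (K + 2) → ℝ × ℝ :=
  -- Only the slow legs count; the values at the fast legs `Sum.inl 0` and `Sum.inr 0` are
  -- placeholders.
  Sum.elim (fun _ => (T.mass c ^ 2 / ∑ j, x j, ∑ j, x j))
    (Fin.cons 0 fun j => -(T.mass (b j) ^ 2 / x j, x j))

theorem slowMomentum_inl (c : Fin r) (b : Fin (K + 1) → Fin r) (x : Fin (K + 1) → ℝ) (k : Fin 2) :
    T.slowMomentum c b x (Sum.inl k) = (T.mass c ^ 2 / ∑ j, x j, ∑ j, x j) := rfl

theorem slowMomentum_inr (c : Fin r) (b : Fin (K + 1) → Fin r) (x : Fin (K + 1) → ℝ)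
    (j : Fin (K + 1)) :
    T.slowMomentum c b x (Sum.inr j.succ) = -(T.mass (b j) ^ 2 / x j, x j) := rfl

theorem sum_snd_slowMomentum (c : Fin r) (b : Fin (K + 1) → Fin r) (x : Fin (K + 1) → ℝ) :
    ∑ y ∈ restLegs (Sum.inl 0) (Sum.inr 0), (T.slowMomentum c b x y).2 = 0 := by
  simp [sum_restLegs, slowMomentum_inl, slowMomentum_inr]

/-- Outgoing legs contribute only negative terms. A part with the incoming leg is the complement of
such a part, and the total is zero. -/
theorem sum_snd_slowMomentum_ne (c : Fin r) (b : Fin (K + 1) → Fin r) {x : Fin (K + 1) → ℝ}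
    (hx : ∀ j, 0 < x j) (U : Finset (Fin 2 ⊕ Fin (K + 2)))
    (hU : U ⊂ restLegs (Sum.inl 0) (Sum.inr 0)) (hne : U.Nonempty) :
    ∑ y ∈ U, (T.slowMomentum c b x y).2 ≠ 0 := by
  have key : ∀ V ⊆ restLegs (Sum.inl 0) (Sum.inr 0), V.Nonempty → Sum.inl 1 ∉ V →
      ∑ y ∈ V, (T.slowMomentum c b x y).2 < 0 := by
    intro V hV hne h1
    rw [← neg_pos, ← Finset.sum_neg_distrib]
    refine Finset.sum_pos (fun y hy => ?_) hne
    have := hV hy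
    rcases mem_restLegs_process.1 this with rfl | ⟨j, rfl⟩
    · exact absurd hy h1
    · simpa [slowMomentum_inr] using hx j
  by_cases h1 : Sum.inl 1 ∈ U
  · have h2 := Finset.sum_sdiff (f := fun y => (T.slowMomentum c b x y).2) hU.subset
    rw [sum_snd_slowMomentum] at h2
    have h3 := key _ Finset.sdiff_subset (Finset.sdiff_nonempty.2 hU.not_subset) (fun h =>
      (Finset.mem_sdiff.1 h).2 h1)
    intro h0
    rw [h0, add_zero] at h2
    exact h3.ne h2
  · exact (key U hU.subset hne h1).ne

/-- Powers of a large number are generic light-cone momenta. -/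
theorem msq_slowMomentum_ne (c : Fin r) (b : Fin (K + 1) → Fin r) {t : ℝ}
    (ht : ∀ e d, ((K + 1 : ℕ) : ℝ) * T.mass d ^ 2 < t * T.mass e ^ 2)
    (U : Finset (Fin 2 ⊕ Fin (K + 2)))
    (hU : U ⊂ restLegs (Sum.inl 0) (Sum.inr 0)) (hc : 2 ≤ U.card) (e : Fin r) :
    msq (∑ y ∈ U, T.slowMomentum c b (fun j => t ^ (j.1 + 1)) y) ≠ T.mass e ^ 2 := by
  have hmp : ∀ d, 0 < T.mass d ^ 2 := fun d => pow_pos (T.mass_pos d) 2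
  have hK : (1 : ℝ) ≤ ((K + 1 : ℕ) : ℝ) := by
    push_cast
    linarith [Nat.cast_nonneg (α := ℝ) K]
  have ht1 : 1 < t := by
    have := ht c c
    have := hmp c
    nlinarith
  have ht0 : 0 < t := by linarith
  have ht' : ∀ e d, T.mass d ^ 2 < t * T.mass e ^ 2 := fun e d => by
    have := ht e d
    have := hmp d
    nlinarith
  set A : Finset (Fin (K + 1)) := Finset.univ.filter fun j => Sum.inr j.succ ∈ U with hA
  have hpos : ∀ j : Fin (K + 1), 0 < T.mass (b j) ^ 2 / t ^ (j.1 + 1) := fun j =>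
    div_pos (hmp _) (pow_pos ht0 _)
  have hsum := sum_subset_restLegs (T.slowMomentum c b (fun j => t ^ (j.1 + 1))) hU.subset
  rw [hsum, msq, Prod.fst_add, Prod.snd_add, Prod.fst_sum, Prod.snd_sum]
  simp only [slowMomentum_inr, Prod.fst_neg, Prod.snd_neg, Finset.sum_neg_distrib]
  have hge : ∀ j ∈ A, T.mass (b j) ^ 2 / t ^ (j.1 + 1) ≤
      ∑ j ∈ A, T.mass (b j) ^ 2 / t ^ (j.1 + 1) := fun j hj =>
    Finset.single_le_sum (f := fun j : Fin (K + 1) => T.mass (b j) ^ 2 / t ^ (j.1 + 1))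
      (fun k _ => (hpos k).le) hj
  have hge' : ∀ j ∈ A, t ^ (j.1 + 1) ≤ ∑ j ∈ A, t ^ (j.1 + 1) := fun j hj =>
    Finset.single_le_sum (f := fun j : Fin (K + 1) => t ^ (j.1 + 1))
      (fun k _ => (pow_pos ht0 _).le) hj
  by_cases h1 : Sum.inl 1 ∈ U
  · rw [if_pos h1, slowMomentum_inl]
    have hAne : A.Nonempty := by
      by_contra hA0
      have h2 : U ⊆ {Sum.inl 1} := fun y hy => by
        have := hU.subset hy
        rcases mem_restLegs_process.1 this with rfl | ⟨j, rfl⟩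
        · simp
        · exact absurd ⟨j, Finset.mem_filter.2 ⟨Finset.mem_univ _, hy⟩⟩ hA0
      have := Finset.card_le_card h2
      rw [Finset.card_singleton] at this
      omega
    have hAc : Aᶜ.Nonempty := by
      obtain ⟨y, hy, hyU⟩ := Finset.exists_of_ssubset hU
      rcases mem_restLegs_process.1 hy with rfl | ⟨j, rfl⟩
      · exact absurd h1 hyU
      · exact ⟨j, by simpa [hA] using hyU⟩
    set X := ∑ j : Fin (K + 1), t ^ (j.1 + 1) with hX
    have hXge : t ^ (K + 1) ≤ X := by
      have := Finset.single_le_sum (f := fun j : Fin (K + 1) => t ^ (j.1 + 1))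
        (fun k _ => (pow_pos ht0 _).le) (Finset.mem_univ (Fin.last K))
      simpa using this
    have hXpos : 0 < X := (pow_pos ht0 _).trans_le hXge
    have hB : X + -∑ j ∈ A, t ^ (j.1 + 1) = ∑ j ∈ Aᶜ, t ^ (j.1 + 1) := by
      rw [hX, ← Finset.sum_add_sum_compl A]
      ring
    have hBpos : 0 < ∑ j ∈ Aᶜ, t ^ (j.1 + 1) :=
      Finset.sum_pos (fun j _ => pow_pos ht0 _) hAc
    dsimp only
    rw [hB]
    refine ne_of_lt ?_
    have hc1 : T.mass c ^ 2 / X ≤ T.mass c ^ 2 / t ^ (K + 1) := by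
      have := hmp c
      gcongr
    -- If the largest momentum is in the part, the remaining second component is of order at most `t
    -- ^ K`, against a first component at most of order `1 / t ^ (K + 1)`: the square is below every
    -- squared mass. Otherwise some outgoing leg in the part has a first component exceeding the
    -- incoming one, and the square is negative.
    by_cases hlast : Fin.last K ∈ A
    · have h2 : ∑ j ∈ Aᶜ, t ^ (j.1 + 1) ≤ ((K + 1 : ℕ) : ℝ) * t ^ K := by
        have h3 : ∀ j ∈ Aᶜ, t ^ (j.1 + 1) ≤ t ^ K := fun j hj => by
          have hj' : j ≠ Fin.last K := fun h => (Finset.mem_compl.1 hj) (h ▸ hlast)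
          have := Fin.val_lt_last hj'
          exact pow_le_pow_right₀ ht1.le this
        have h4 := Finset.sum_le_card_nsmul _ _ _ h3
        have h5 : Aᶜ.card ≤ K + 1 := by simpa using Finset.card_le_univ Aᶜ
        rw [nsmul_eq_mul] at h4
        refine h4.trans ?_
        gcongr
      have h3 : 0 < ∑ j ∈ A, T.mass (b j) ^ 2 / t ^ (j.1 + 1) :=
        Finset.sum_pos (fun j _ => hpos j) hAne
      calc _ ≤ T.mass c ^ 2 / t ^ (K + 1) * ∑ j ∈ Aᶜ, t ^ (j.1 + 1) := by
            gcongr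
            linarith
        _ ≤ T.mass c ^ 2 / t ^ (K + 1) * (((K + 1 : ℕ) : ℝ) * t ^ K) := by
            have := hmp c
            gcongr
        _ = ((K + 1 : ℕ) : ℝ) * T.mass c ^ 2 / t := by
            rw [pow_succ t K]
            field_simp
        _ < T.mass e ^ 2 := by
            rw [div_lt_iff₀ ht0, mul_comm (T.mass e ^ 2)]
            exact ht e c
    · obtain ⟨j, hj⟩ := hAne
      have hj' : j ≠ Fin.last K := fun h => hlast (h ▸ hj)
      have hjK := Fin.val_lt_last hj'
      have h2 : T.mass c ^ 2 / t ^ (K + 1) < T.mass (b j) ^ 2 / t ^ (j.1 + 1) := by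
        have h3 : t ^ (j.1 + 1) * t ≤ t ^ (K + 1) := by
          rw [← pow_succ]
          exact pow_le_pow_right₀ ht1.le (by omega)
        rw [div_lt_div_iff₀ (pow_pos ht0 _) (pow_pos ht0 _)]
        calc T.mass c ^ 2 * t ^ (j.1 + 1) < t * T.mass (b j) ^ 2 * t ^ (j.1 + 1) :=
              mul_lt_mul_of_pos_right (ht' _ _) (pow_pos ht0 _)
          _ = T.mass (b j) ^ 2 * (t ^ (j.1 + 1) * t) := by ring
          _ ≤ _ := by
            have := hmp (b j)
            gcongr
      refine lt_trans (mul_neg_of_neg_of_pos ?_ hBpos) (hmp e)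
      have := hge j hj
      linarith
  · rw [if_neg h1, Prod.fst_zero, Prod.snd_zero, zero_add, zero_add, neg_mul_neg]
    refine ne_of_gt ?_
    have hAcard : 1 < A.card := by
      have h2 : U ⊆ A.image fun j => Sum.inr j.succ := fun y hy => by
        have := hU.subset hy
        rcases mem_restLegs_process.1 this with rfl | ⟨j, rfl⟩
        · exact absurd hy h1
        · exact Finset.mem_image.2 ⟨j, Finset.mem_filter.2 ⟨Finset.mem_univ _, hy⟩, rfl⟩
      have h3 := (Finset.card_le_card h2).trans Finset.card_image_le
      omega
    -- Two outgoing legs at different scales already produce a square of order at least `t`, above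
    -- every squared mass.
    obtain ⟨u, hu, v, hv, huv⟩ : ∃ u ∈ A, ∃ v ∈ A, u < v := by
      obtain ⟨u, hu, v, hv, huv⟩ := Finset.one_lt_card.1 hAcard
      rcases lt_or_gt_of_ne huv with h | h
      · exact ⟨u, hu, v, hv, h⟩
      · exact ⟨v, hv, u, hu, h⟩
    calc T.mass e ^ 2 < t * T.mass (b u) ^ 2 := ht' _ _
      _ = T.mass (b u) ^ 2 / t ^ (u.1 + 1) * (t ^ (u.1 + 1) * t) := by
        field_simp
      _ ≤ T.mass (b u) ^ 2 / t ^ (u.1 + 1) * t ^ (v.1 + 1) := by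
        have := (hpos u).le
        gcongr
        rw [← pow_succ]
        exact pow_le_pow_right₀ ht1.le (by have : u.1 < v.1 := huv; omega)
      _ ≤ _ := by
        have h4 := (hpos u).le.trans (hge u hu)
        have h5 := (pow_pos ht0 (v.1 + 1)).le
        exact mul_le_mul (hge u hu) (hge' v hv) h5 h4

end Kinematics
-- Consequences of elasticity and the universal limit
section Main

variable {K r : ℕ} (T : ScalarTheory r)

theorem onShell_log {m x : ℝ} (hm : 0 < m) (hx : 0 < x) :
    onShell m (-Real.log (x / m)) = (m ^ 2 / x, x) := by
  have h := div_pos hx hm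
  rw [onShell, neg_neg, Real.exp_neg, Real.exp_log h]
  ext <;> simp <;> field_simp

theorem sum_legMomentum {m n : ℕ} (a : Fin m → Fin r) (α : Fin m → ℝ) (b : Fin n → Fin r)
    (β : Fin n → ℝ) :
    ∑ x, T.legMomentum a α b β x =
      ∑ i, onShell (T.mass (a i)) (α i) - ∑ j, onShell (T.mass (b j)) (β j) := by
  rw [Fintype.sum_sum_type, sub_eq_add_neg, ← Finset.sum_neg_distrib]
  rfl

/-- There are physical processes in which a fast particle of type `i` and a particle of type `c`
scatter into a fast particle of type `i` and particles of types `b j` with prescribed momenta. -/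
theorem exists_forwardLimit (i c : Fin r) (b : Fin (K + 1) → Fin r) {x : Fin (K + 1) → ℝ}
    (hx : ∀ j, 0 < x j)
    (hms : ∀ U ⊂ restLegs (Sum.inl 0) (Sum.inr 0), 2 ≤ U.card → ∀ e,
      msq (∑ y ∈ U, T.slowMomentum c b x y) ≠ T.mass e ^ 2) :
    ∃ (α : ℕ → Fin 2 → ℝ) (β : ℕ → Fin (K + 2) → ℝ),
      T.ForwardLimit atTop (Sum.inl 0) (Sum.inr 0)
        (fun n => T.legMomentum ![i, c] (α n) (Fin.cons i b : Fin (K + 2) → Fin r) (β n))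
        (T.slowMomentum c b x) ∧
      Tendsto (fun n => α n 0) atTop atTop ∧ ∀ n j, β n (Fin.succ j) = β 0 (Fin.succ j) := by
  have hX : 0 < ∑ j, x j := Finset.sum_pos (fun j _ => hx j) Finset.univ_nonempty
  obtain ⟨θ, θ', α, h1, h2, h3, h4, h5⟩ := exists_fast_kinematics (T.mass_pos i) (T.mass_pos c) hX
    (∑ j, T.mass (b j) ^ 2 / x j)
  refine ⟨fun n => ![θ n, α n], fun n => Fin.cons (θ' n) fun j => -Real.log (x j / T.mass (b j)),
    ⟨by simp, fun n => ?_, ?_, ?_, fun y hy => ?_, T.sum_snd_slowMomentum c b x,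
      T.sum_snd_slowMomentum_ne c b hx, hms⟩, h1, fun n j => rfl⟩
  · rw [sum_legMomentum, Fin.sum_univ_two, Fin.sum_univ_succ, sub_eq_zero]
    simp only [Fin.cons_zero, Fin.cons_succ, Matrix.cons_val_zero, Matrix.cons_val_one,
      onShell_log (T.mass_pos _) (hx _)]
    ext
    · simpa [onShell, Prod.fst_sum] using h4 n
    · simpa [onShell, Prod.snd_sum] using h5 n
  · have : Tendsto (fun n => T.mass i * Real.exp (θ' n)) atTop atTop :=
      (Real.tendsto_exp_atTop.comp h2).const_mul_atTop (T.mass_pos i)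
    refine this.congr fun n => ?_
    simp [legMomentum, onShell, abs_of_pos (T.mass_pos i)]
  · have : Tendsto (fun n => -(T.mass i * Real.exp (-θ' n))) atTop (𝓝 (-(T.mass i * 0))) :=
      ((Real.tendsto_exp_neg_atTop_nhds_zero.comp h2).const_mul _).neg
    rw [mul_zero, neg_zero] at this
    refine this.congr fun n => ?_
    simp [legMomentum, onShell]
  · rcases mem_restLegs_process.1 hy with rfl | ⟨j, rfl⟩
    · rw [slowMomentum_inl]
      suffices Tendsto (fun n => T.mass c * Real.exp (α n)) atTop (𝓝 (T.mass c ^ 2 / ∑ j, x j)) from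
        this.prodMk_nhds h3
      refine ((tendsto_const_nhds (x := T.mass c ^ 2)).div h3 hX.ne').congr fun n => ?_
      have := T.mass_pos c
      rw [Pi.div_apply, Real.exp_neg]
      field_simp
    · rw [slowMomentum_inr, ← onShell_log (T.mass_pos _) (hx _)]
      exact tendsto_const_nhds

variable {T}

/-- The amplitudes of these processes vanish, unless the process is elastic. -/
theorem PurelyElastic.eventually_treeSum_eq_zero (hE : T.PurelyElastic) {i c : Fin r}
    {b : Fin (K + 1) → Fin r} {P : Fin 2 ⊕ Fin (K + 2) → ℝ × ℝ} {α : ℕ → Fin 2 → ℝ}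
    {β : ℕ → Fin (K + 2) → ℝ}
    (h : T.ForwardLimit atTop (Sum.inl 0) (Sum.inr 0)
        (fun n => T.legMomentum ![i, c] (α n) (Fin.cons i b : Fin (K + 2) → Fin r) (β n)) P)
    (hα : Tendsto (fun n => α n 0) atTop atTop)
    (hβ : ∀ n j, β n (Fin.succ j) = β 0 (Fin.succ j)) (hne : 1 ≤ K ∨ ∀ j, b j ≠ c) :
    ∀ᶠ n in atTop, T.treeSum (Sum.inl 0) (T.legType ![i, c] (Fin.cons i b : Fin (K + 2) → Fin r))
      (T.legMomentum ![i, c] (α n) (Fin.cons i b : Fin (K + 2) → Fin r) (β n)) = 0 := by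
  filter_upwards [h.eventually_nonsingular,
    hα.eventually_gt_atTop (β 0 (Fin.succ 0))] with n hn hn'
  refine hE 1 (K + 2) ![i, c] (α n) (Fin.cons i b) (β n) (by omega) ?_ ?_ hn
  · rw [← sub_eq_zero, ← sum_legMomentum]
    exact h.conserved n
  · intro heq
    -- For `1 ≤ K` the numbers of particles differ. For `K = 0` the fast incoming particle can only
    -- match the fast outgoing one, as its rapidity exceeds the fixed slow one; so `c` would have to
    -- equal `b 0`.
    rcases hne with hK | hb
    · have := congrArg Multiset.card heq
      simp at this
      omega
    · obtain rfl : K = 0 := by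
        have := congrArg Multiset.card heq
        simp at this
        omega
      have hpair : ∀ f : Fin 2 → Fin r × ℝ, Finset.univ.val.map f = f 0 ::ₘ {f 1} := fun _ => rfl
      have heq : ((i, α n 0) ::ₘ {(c, α n 1)} : Multiset (Fin r × ℝ)) =
          (i, β n 0) ::ₘ {(b 0, β n (Fin.succ 0))} := (hpair _).symm.trans (heq.trans (hpair _))
      have hmem : (i, α n 0) ∈ ((i, β n 0) ::ₘ {(b 0, β n (Fin.succ 0))} :
          Multiset (Fin r × ℝ)) := heq ▸ Multiset.mem_cons_self _ _
      rw [Multiset.mem_cons, Multiset.mem_singleton] at hmem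
      rcases hmem with h1 | h1
      · rw [h1, Multiset.cons_inj_right, Multiset.singleton_inj] at heq
        exact hb 0 (congrArg Prod.fst heq).symm
      · have h2 : α n 0 = β n (Fin.succ 0) := congrArg Prod.snd h1
        rw [hβ n 0] at h2
        exact hn'.ne' h2

/-- A fast particle cannot scatter forward while a slow particle changes its type. -/
theorem PurelyElastic.forwardVertex_pair (hE : T.PurelyElastic) (i c e : Fin r)
    (he : e ≠ T.bar c) : T.forwardVertex i {c, e} = 0 := by
  -- An outgoing `bar e` counts as an incoming field `e`.
  obtain ⟨α, β, h, hα, hβ⟩ := T.exists_forwardLimit (K := 0) i c (fun _ => T.bar e)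
    (x := fun _ => 1) (fun _ => one_pos) (fun U hU hc => by
      have := Finset.card_lt_card hU
      rw [card_restLegs_process] at this
      omega)
  have h0 := hE.eventually_treeSum_eq_zero h hα hβ (Or.inr fun _ h' => he (by
    rw [← h', T.bar_bar]))
  have h1 := h.tendsto_treeSum_two
    (a := T.legType ![i, c] (Fin.cons i fun _ => T.bar e : Fin 2 → Fin r)) rfl
    card_restLegs_process
  have h2 := tendsto_nhds_unique h1 (tendsto_const_nhds.congr' (EventuallyEq.symm h0))
  rw [map_restLegs] at h2
  have h3 : (T.legType ![i, c] (Fin.cons i fun _ => T.bar e : Fin 2 → Fin r) (Sum.inl 1) ::ₘ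
      Finset.univ.val.map fun j : Fin 1 => T.legType ![i, c]
        (Fin.cons i fun _ => T.bar e : Fin 2 → Fin r) (Sum.inr j.succ)) = {c, e} := by
    simp [legType, T.bar_bar]
  rw [h3] at h2
  simpa [legType] using h2

/-- The slope, relative to the squared mass, of the forward amplitude of `i` on `a`. -/
noncomputable def forwardRatio (T : ScalarTheory r) (i a : Fin r) : ℂ :=
  T.forwardVertex i {a, T.bar a} / ((T.mass a ^ 2 : ℝ) : ℂ)

theorem mass_sq_ne_zero (T : ScalarTheory r) (a : Fin r) : ((T.mass a ^ 2 : ℝ) : ℂ) ≠ 0 := by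
  exact_mod_cast (pow_pos (T.mass_pos a) 2).ne'

theorem forwardRatio_bar (i a : Fin r) : T.forwardRatio i (T.bar a) = T.forwardRatio i a := by
  rw [forwardRatio, forwardRatio, T.bar_bar, T.mass_bar, Multiset.pair_comm]

/-- With second components `t ^ (j + 1)` the first components are `m ^ 2 / t ^ (j + 1)`, so after
multiplication by `t` only `j = 0` survives. The incoming leg is suppressed by `t ^ (K + 1)`, which
needs `1 ≤ K`. -/
theorem tendsto_mul_fst_slowMomentum (hK : 1 ≤ K) (c : Fin r) (b : Fin (K + 1) → Fin r) :
    ∀ y ∈ restLegs (Sum.inl 0) (Sum.inr 0),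
    Tendsto (fun t : ℝ => t * (T.slowMomentum c b (fun j => t ^ (j.1 + 1)) y).1) atTop
      (𝓝 (if y = Sum.inr (Fin.succ 0) then -T.mass (b 0) ^ 2 else 0)) := by
  intro y hy
  rcases mem_restLegs_process.1 hy with rfl | ⟨j, rfl⟩
  · rw [if_neg (by simp)]
    have h1 : Tendsto (fun t : ℝ => T.mass c ^ 2 / t) atTop (𝓝 0) :=
      tendsto_id.const_div_atTop _
    refine squeeze_zero' ?_ ?_ h1
    · filter_upwards [eventually_ge_atTop 0] with t ht
      rw [slowMomentum_inl]
      have : 0 ≤ ∑ j : Fin (K + 1), t ^ (j.1 + 1) := Finset.sum_nonneg fun j _ => by positivity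
      positivity
    · filter_upwards [eventually_ge_atTop 1] with t ht
      have ht0 : 0 < t := by linarith
      rw [slowMomentum_inl]
      have h2 : t ^ 2 ≤ ∑ j : Fin (K + 1), t ^ (j.1 + 1) := by
        refine le_trans (pow_le_pow_right₀ ht (by omega : 2 ≤ K + 1)) ?_
        have := Finset.single_le_sum (f := fun j : Fin (K + 1) => t ^ (j.1 + 1))
          (fun k _ => (pow_pos ht0 _).le) (Finset.mem_univ (Fin.last K))
        simpa using this
      calc t * (T.mass c ^ 2 / ∑ j : Fin (K + 1), t ^ (j.1 + 1)) ≤ t * (T.mass c ^ 2 / t ^ 2) := by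
            gcongr
        _ = T.mass c ^ 2 / t := by field_simp
  · simp only [slowMomentum_inr, Sum.inr.injEq, Fin.succ_inj, Prod.fst_neg]
    have h1 : ∀ᶠ t : ℝ in atTop, -(T.mass (b j) ^ 2 / t ^ j.1) =
        t * -(T.mass (b j) ^ 2 / t ^ (j.1 + 1)) := by
      filter_upwards [eventually_gt_atTop 0] with t ht
      rw [pow_succ t j.1]
      field_simp
    refine Tendsto.congr' h1 ?_
    split_ifs with hj
    · subst hj
      simp
    · have hj' : j.1 ≠ 0 := fun h => hj (Fin.ext h)
      simpa using ((tendsto_pow_atTop hj').const_div_atTop (T.mass (b j) ^ 2)).neg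

/-- If the smaller vertices are uniform, the forward vertex is the coupling times the ratio of any
of its fields. -/
theorem PurelyElastic.forwardVertex_eq (hE : T.PurelyElastic) (i c : Fin r)
    (f : Fin (K + 1) → Fin r) (hK : 1 ≤ K)
    (hV : ∀ s : Multiset (Fin r), 3 ≤ s.card → s.card < K + 2 →
      T.coupling s ≠ 0 → Uniform (T.forwardRatio i) s)
    (hW : ∀ s : Multiset (Fin r), 2 ≤ s.card → s.card < K + 2 →
      T.forwardVertex i s ≠ 0 → Uniform (T.forwardRatio i) s)
    (hmix : ¬ Uniform (T.forwardRatio i) (c ::ₘ Finset.univ.val.map f)) :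
    T.forwardVertex i (c ::ₘ Finset.univ.val.map f) =
      T.coupling (c ::ₘ Finset.univ.val.map f) * T.forwardRatio i (f 0) := by
  set s := c ::ₘ Finset.univ.val.map f with hs
  set b : Fin (K + 1) → Fin r := fun j => T.bar (f j) with hb
  set a : Fin 2 ⊕ Fin (K + 2) → Fin r :=
    T.legType ![i, c] (Fin.cons i b : Fin (K + 2) → Fin r) with ha
  have ha1 : a (Sum.inl 1) = c := rfl
  have ha2 : ∀ j : Fin (K + 1), a (Sum.inr j.succ) = f j := fun j => T.bar_bar (f j)
  have hmap : (restLegs (Sum.inl 0) (Sum.inr 0)).val.map a = s := by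
    rw [map_restLegs, ha1]
    simp only [ha2, hs]
  have key : ∀ᶠ t : ℝ in atTop, ∑ y ∈ restLegs (Sum.inl 0) (Sum.inr 0),
      (T.forwardVertex i s - T.coupling s * T.forwardRatio i (a y)) *
        (((T.slowMomentum c b (fun j => t ^ (j.1 + 1)) y).1 : ℝ) : ℂ) = 0 := by
    have ht : ∀ᶠ t : ℝ in atTop, ∀ e d, ((K + 1 : ℕ) : ℝ) * T.mass d ^ 2 < t * T.mass e ^ 2 := by
      rw [eventually_all]
      intro e
      rw [eventually_all]
      intro d
      exact (tendsto_id.atTop_mul_const (pow_pos (T.mass_pos e) 2)).eventually_gt_atTop _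
    filter_upwards [ht, eventually_gt_atTop 0] with t ht ht0
    have hX : 0 < ∑ j : Fin (K + 1), t ^ (j.1 + 1) :=
      Finset.sum_pos (fun j _ => pow_pos ht0 _) Finset.univ_nonempty
    obtain ⟨α, β, h, hα, hβ⟩ := T.exists_forwardLimit i c b (x := fun j => t ^ (j.1 + 1))
      (fun j => pow_pos ht0 _) (T.msq_slowMomentum_ne c b ht)
    have h0 := hE.eventually_treeSum_eq_zero h hα hβ (Or.inl hK)
    have hcard := card_restLegs_process (K := K)
    rw [← hmap]
    refine h.forwardVertex_relation (a := a) rfl ?_ (forwardRatio_bar i) ?_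
      (by rwa [hcard]) (by rwa [hcard]) (fun d e => hE.forwardVertex_pair i d e)
      (by rwa [hmap]) (by omega) h0
    · intro y hy
      rcases mem_restLegs_process.1 hy with rfl | ⟨j, rfl⟩
      · rw [slowMomentum_inl, msq, ha1]
        field_simp
      · rw [slowMomentum_inr, msq_neg, msq, ha2, hb]
        dsimp only
        rw [T.mass_bar]
        have := pow_pos ht0 (j.1 + 1)
        field_simp
    · intro d
      exact (div_mul_cancel₀ _ (T.mass_sq_ne_zero d)).symm
  -- Multiplying the relation by `t` and letting `t` tend to infinity leaves only the term of `f 0`.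
  have hlim : Tendsto (fun t : ℝ => ∑ y ∈ restLegs (Sum.inl 0) (Sum.inr 0),
      (T.forwardVertex i s - T.coupling s * T.forwardRatio i (a y)) *
        ((t * (T.slowMomentum c b (fun j => t ^ (j.1 + 1)) y).1 : ℝ) : ℂ)) atTop
      (𝓝 (∑ y ∈ restLegs (Sum.inl 0) (Sum.inr 0),
      (T.forwardVertex i s - T.coupling s * T.forwardRatio i (a y)) *
        ((if y = Sum.inr (Fin.succ 0) then -T.mass (b 0) ^ 2 else 0 : ℝ) : ℂ))) :=
    tendsto_finsetSum _ fun y hy => Tendsto.const_mul _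
      ((Complex.continuous_ofReal.tendsto _).comp (tendsto_mul_fst_slowMomentum hK c b y hy))
  have hzero := tendsto_nhds_unique hlim (tendsto_const_nhds.congr' (f₁ := fun _ => (0 : ℂ)) (by
    filter_upwards [key] with t ht
    have h1 := congrArg (fun z : ℂ => (t : ℂ) * z) ht
    simp only [mul_zero, Finset.mul_sum] at h1
    rw [← h1]
    refine Finset.sum_congr rfl fun y _ => ?_
    push_cast
    ring))
  rw [Finset.sum_eq_single (Sum.inr (Fin.succ 0))] at hzero
  · rw [if_pos rfl, ha2] at hzero
    have hm : ((-T.mass (b 0) ^ 2 : ℝ) : ℂ) ≠ 0 := by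
      push_cast
      simpa using (T.mass_pos (b 0)).ne'
    exact sub_eq_zero.1 ((mul_eq_zero.1 hzero).resolve_right hm)
  · intro y _ hy
    rw [if_neg hy]
    simp
  · intro h
    exact absurd (mem_restLegs_process.2 (Or.inr ⟨0, rfl⟩)) h

/-- The order of the fields is free, so any `d` in `s` can be put in the slot whose momentum is
isolated, with some other field as the incoming one. -/
theorem PurelyElastic.forwardVertex_eq_of_mem (hE : T.PurelyElastic) (i : Fin r)
    {s : Multiset (Fin r)} (hs : 3 ≤ s.card)
    (hV : ∀ s' : Multiset (Fin r), 3 ≤ s'.card → s'.card < s.card →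
      T.coupling s' ≠ 0 → Uniform (T.forwardRatio i) s')
    (hW : ∀ s' : Multiset (Fin r), 2 ≤ s'.card → s'.card < s.card →
      T.forwardVertex i s' ≠ 0 → Uniform (T.forwardRatio i) s')
    (hmix : ¬ Uniform (T.forwardRatio i) s) {d : Fin r} (hd : d ∈ s) :
    T.forwardVertex i s = T.coupling s * T.forwardRatio i d := by
  obtain ⟨s₁, rfl⟩ := Multiset.exists_cons_of_mem hd
  rw [Multiset.card_cons] at hs
  obtain ⟨c, hc⟩ := Multiset.card_pos_iff_exists_mem.1 (by omega : 0 < s₁.card)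
  obtain ⟨s₂, rfl⟩ := Multiset.exists_cons_of_mem hc
  induction s₂ using Quotient.inductionOn with
  | h l =>
    have hf : d ::ₘ c ::ₘ (l : Multiset (Fin r)) =
        c ::ₘ Finset.univ.val.map fun j : Fin (l.length + 1) => (d :: l).get j := by
      rw [Multiset.cons_swap, Fin.univ_val_map]
      congr 1
      exact congrArg _ (List.ofFn_get (d :: l)).symm
    change ¬ Uniform _ (d ::ₘ c ::ₘ (l : Multiset (Fin r))) at hmix
    change T.forwardVertex i (d ::ₘ c ::ₘ (l : Multiset (Fin r))) =
      T.coupling (d ::ₘ c ::ₘ (l : Multiset (Fin r))) * _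
    have hcard : (d ::ₘ c ::ₘ (l : Multiset (Fin r))).card = l.length + 2 := by simp
    have hl : 1 ≤ l.length := by
      simp at hs
      omega
    have hV' : ∀ s' : Multiset (Fin r), 3 ≤ s'.card → s'.card < l.length + 2 →
        T.coupling s' ≠ 0 → Uniform (T.forwardRatio i) s' :=
      fun s' h1 h2 => hV s' h1 (h2.trans_eq hcard.symm)
    have hW' : ∀ s' : Multiset (Fin r), 2 ≤ s'.card → s'.card < l.length + 2 →
        T.forwardVertex i s' ≠ 0 → Uniform (T.forwardRatio i) s' :=
      fun s' h1 h2 => hW s' h1 (h2.trans_eq hcard.symm)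
    rw [hf] at hmix ⊢
    exact hE.forwardVertex_eq i c _ hl hV' hW' hmix

/-- Every vertex only contains fields with the same forward ratio. -/
theorem PurelyElastic.uniform (hE : T.PurelyElastic) (i : Fin r) (k : ℕ) :
    ∀ s : Multiset (Fin r), s.card = k →
      (3 ≤ k → T.coupling s ≠ 0 → Uniform (T.forwardRatio i) s) ∧
      (2 ≤ k → T.forwardVertex i s ≠ 0 → Uniform (T.forwardRatio i) s) := by
  induction k using Nat.strong_induction_on with
  | _ k ih =>
    intro s hs
    by_cases hmix : Uniform (T.forwardRatio i) s
    · exact ⟨fun _ _ => hmix, fun _ _ => hmix⟩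
    have key : 3 ≤ k → T.coupling s = 0 ∧ T.forwardVertex i s = 0 := by
      intro hk
      have h1 : ∀ d ∈ s, T.forwardVertex i s = T.coupling s * T.forwardRatio i d := fun d hd =>
        hE.forwardVertex_eq_of_mem i (hs ▸ hk)
          (fun s' h3 hlt => (ih s'.card (hs ▸ hlt) s' rfl).1 h3)
          (fun s' h2 hlt => (ih s'.card (hs ▸ hlt) s' rfl).2 h2) hmix hd
      -- A nonzero coupling could be cancelled, making the ratio the same for all fields of `s`.
      have h2 : T.coupling s = 0 := by
        by_contra hne
        exact hmix fun a ha b hb => mul_left_cancel₀ hne ((h1 a ha).symm.trans (h1 b hb))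
      obtain ⟨d, hd⟩ := Multiset.card_pos_iff_exists_mem.1 (by omega : 0 < s.card)
      exact ⟨h2, by rw [h1 d hd, h2, zero_mul]⟩
    refine ⟨fun hk h => absurd (key hk).1 h, fun hk h => ?_⟩
    by_cases hk3 : 3 ≤ k
    · exact absurd (key hk3).2 h
    · obtain ⟨a, b, rfl⟩ := Multiset.card_eq_two.1 (by omega : s.card = 2)
      by_cases hb : b = T.bar a
      · refine absurd ?_ hmix
        subst hb
        have : ∀ x ∈ ({a, T.bar a} : Multiset (Fin r)), T.forwardRatio i x = T.forwardRatio i a := by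
          intro x hx
          simp only [Multiset.insert_eq_cons, Multiset.mem_cons, Multiset.mem_singleton] at hx
          rcases hx with rfl | rfl
          · rfl
          · exact forwardRatio_bar i a
        exact fun x hx y hy => (this x hx).trans (this y hy).symm
      · exact absurd (hE.forwardVertex_pair i a b hb) h

/-- A level set of the ratio is closed under conjugation, and no nonzero coupling mixes it with its
complement; so it cannot be proper. -/
theorem forwardRatio_eq (hI : T.Indecomposable) (hE : T.PurelyElastic) (i a b : Fin r) :
    T.forwardRatio i a = T.forwardRatio i b := by
  by_contra hne
  set A : Finset (Fin r) := Finset.univ.filter fun x => T.forwardRatio i x = T.forwardRatio i a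
    with hA
  obtain ⟨s, hs, hs0, ⟨x, hx, hxA⟩, y, hy, hyA⟩ := hI A ⟨a, by simp [hA]⟩
    (fun h => hne (by
      have : b ∈ A := h ▸ Finset.mem_univ b
      exact (Finset.mem_filter.1 this).2.symm))
    (fun x hx => by
      rw [hA, Finset.mem_filter] at hx ⊢
      exact ⟨Finset.mem_univ _, (forwardRatio_bar i x).trans hx.2⟩)
  refine hyA (Finset.mem_filter.2 ⟨Finset.mem_univ _, ?_⟩)
  rw [← (Finset.mem_filter.1 hxA).2]
  exact (hE.uniform i _ s rfl).1 hs hs0 y hy x hx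

theorem forwardVertex_symm (i j : Fin r) :
    T.forwardVertex i {j, T.bar j} = T.forwardVertex j {i, T.bar i} := by
  have hbar : Function.Involutive T.bar := T.bar_bar
  unfold forwardVertex
  congr 1
  · congr 1
    simp only [Multiset.insert_eq_cons, ← Multiset.singleton_add]
    abel
  -- Exchanging `i` and `j` reverses the exchanged line, which is undone by summing over `bar e`
  -- instead of `e`.
  · rw [← Equiv.sum_comp hbar.toPerm]
    refine Finset.sum_congr rfl fun e _ => ?_
    simp only [Function.Involutive.coe_toPerm, T.bar_bar, T.mass_bar]
    rw [mul_comm]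
    congr 3
    all_goals
      simp only [Multiset.insert_eq_cons, ← Multiset.singleton_add]
      abel

/-- The elastic process is itself a forward limit with constant slow momenta. With two slow legs no
proper part has two elements, so no condition on the masses arises. -/
theorem tendsto_elasticAmplitude (T : ScalarTheory r) (i j : Fin r) :
    Tendsto (T.elasticAmplitude i j) atTop
      (𝓝 (-Complex.I * T.forwardVertex i {j, T.bar j})) := by
  have hm : T.mass j ^ 2 / T.mass j = T.mass j := by
    have := T.mass_pos j
    field_simp
  have h : T.ForwardLimit atTop (Sum.inl 0) (Sum.inr 0)
      (fun θ : ℝ => T.legMomentum ![i, j] ![θ, 0] ![i, j] ![θ, 0])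
      (T.slowMomentum (K := 0) j (fun _ => j) (fun _ => T.mass j)) := by
    refine ⟨by simp, fun θ => ?_, ?_, ?_, fun y hy => ?_, T.sum_snd_slowMomentum _ _ _,
      T.sum_snd_slowMomentum_ne _ _ (fun _ => T.mass_pos j), fun U hU hc => ?_⟩
    · rw [sum_legMomentum, sub_self]
    · have : Tendsto (fun θ => T.mass i * Real.exp θ) atTop atTop :=
        Real.tendsto_exp_atTop.const_mul_atTop (T.mass_pos i)
      refine this.congr fun n => ?_
      simp [legMomentum, onShell, abs_of_pos (T.mass_pos i)]
    · have : Tendsto (fun θ => -(T.mass i * Real.exp (-θ))) atTop (𝓝 (-(T.mass i * 0))) :=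
        (Real.tendsto_exp_neg_atTop_nhds_zero.const_mul _).neg
      rw [mul_zero, neg_zero] at this
      refine this.congr fun n => ?_
      simp [legMomentum, onShell]
    · refine tendsto_const_nhds.congr fun θ => ?_
      rcases mem_restLegs_process.1 hy with rfl | ⟨k, rfl⟩
      · simp [slowMomentum_inl, legMomentum, onShell, hm]
      · obtain rfl : k = 0 := Fin.fin_one_eq_zero k
        rw [slowMomentum_inr]
        simp [legMomentum, onShell, hm]
    · have := Finset.card_lt_card hU
      rw [card_restLegs_process] at this
      omega
  have h1 := h.tendsto_treeSum_two (a := T.legType ![i, j] ![i, j]) rfl card_restLegs_process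
  have h2 : (restLegs (Sum.inl 0) (Sum.inr 0)).val.map (T.legType ![i, j] ![i, j]) =
      {j, T.bar j} := by
    simp [map_restLegs (K := 0), legType]
  rw [h2] at h1
  exact h1

end Main
end ScalarTheory

theorem mainTheorem4 (r : ℕ) (T : ScalarTheory r) (hI : T.Indecomposable)
    (hE : T.PurelyElastic) :
    ∃ aInf : ℂ, ∀ i j : Fin r,
      Tendsto (fun θ : ℝ =>
          T.elasticAmplitude i j θ / ((T.mass i ^ 2 * T.mass j ^ 2 : ℝ) : ℂ))
        atTop (𝓝 aInf) := by
  have key : ∀ i j : Fin r, T.forwardVertex i {j, T.bar j} /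
      ((T.mass i ^ 2 * T.mass j ^ 2 : ℝ) : ℂ) =
        T.forwardRatio i j / ((T.mass i ^ 2 : ℝ) : ℂ) := fun i j => by
    rw [ScalarTheory.forwardRatio, div_div, Complex.ofReal_mul, mul_comm ((T.mass j ^ 2 : ℝ) : ℂ)]
  have hsymm : ∀ i j : Fin r, T.forwardRatio i j / ((T.mass i ^ 2 : ℝ) : ℂ) =
      T.forwardRatio j i / ((T.mass j ^ 2 : ℝ) : ℂ) := fun i j => by
    rw [← key, ← key, ScalarTheory.forwardVertex_symm, mul_comm (T.mass i ^ 2)]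
  rcases isEmpty_or_nonempty (Fin r) with hr | ⟨⟨k⟩⟩
  · exact ⟨0, fun i => hr.elim i⟩
  refine ⟨-Complex.I * (T.forwardRatio k k / ((T.mass k ^ 2 : ℝ) : ℂ)), fun i j => ?_⟩
  -- Move from `(k, k)` to `(k, i)` by independence of the second index, to `(i, k)` by symmetry,
  -- and to `(i, j)` by independence again.
  have h1 : T.forwardRatio k k / ((T.mass k ^ 2 : ℝ) : ℂ) =
      T.forwardVertex i {j, T.bar j} / ((T.mass i ^ 2 * T.mass j ^ 2 : ℝ) : ℂ) := by
    rw [key, ScalarTheory.forwardRatio_eq hI hE k k i, hsymm,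
      ScalarTheory.forwardRatio_eq hI hE i k j]
  rw [h1, ← mul_div_assoc]
  exact (T.tendsto_elasticAmplitude i j).div_const _
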